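/- **Theorem 4.3.** Let $K$ be a commutative ring in which $2$ and $3$ are invertible, and let $(V,T)$ be a linear Jordan triple system over $K$: $T:V^3\to V$ is trilinear, $T(x,y,z)=T(z,y,x)$ and $T(u,v,T(x,y,z))=T(T(u,v,x),y,z)-T(x,T(v,u,y),z)+T(x,y,T(u,v,z))$. Put $Q(x)=\tfrac12T(x,\cdot,x)$ and $B(x,y)=\mathrm{id}-T(x,y,\cdot)+Q(x)Q(y)$. Let $\alpha\in\mathrm{End}_K(V)$ be a structural transformation, i.e. $T(\alpha x,y,\alpha z)=\alpha T(x,\alpha y,z)$ for all $x,y,z$, and let $V_\alpha=(V,T_\alpha)$, $T_\alpha(x,y,z)=T(x,\alpha y,z)$, be the $\alpha$-homotope, which is again a Jordan triple system. *The geometry.* To $(V,T)$ belongs the 3-graded Lie algebra $\mathfrak g=V^+\oplus\mathrm{Der}\oplus V^-$ with $V^\pm=V$, where $\mathrm{Der}$ is the Lie algebra of derivations of the Jordan pair $(V^+,V^-)$ and $[x,a]=-\bigl(T(x,a,\cdot),-T(a,x,\cdot)\bigr)$ for $x\in V^+$, $a\in V^-$. Let $G$ be the group generated by $\exp(\mathrm{ad}\,V^+)$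 and $\exp(\mathrm{ad}\,V^-)$, $H\subset G$ the subgroup preserving the grading, $P^\pm=\exp(V^\pm)H$, $X^+=G/P^-$, $X^-=G/P^+$, with base points $o^\pm$ and affine charts $V^\pm\hookrightarrow X^\pm$, $v\mapsto\exp(v).o^\pm$. Call $x\in X^+$ and $a\in X^-$ transversal, $x\top a$, if $(x,a)\in G.(o^+,o^-)$. For $a=g.o^-$ the affine part $\{x: x\top a\}=g.V^+$ carries the affine structure transported from $V^+$ by $g$, and dually for $X^-$. For $x\top a$ and $r\in K$ let $r_{x,a}$ be multiplication by $r$ in the affine part of $a$ with zero vector $x$; for invertible $r$ it extends to a bijection of $X^+$: if $(x,a)=g.(o^+,o^-)$, it is $g\,\delta_r\,g^{-1}$, where $\delta_r$ is induced by the automorphism $(r,\mathrm{id},r^{-1})$ of $\mathfrak g$. Dually one has $r_{a,x}$ on $X^-$. A homomorphism of such geometries is a pair of maps compatible with transversality and with all these scalar multiplications and vector additions. A polarity is a bijection $q:X^+\to X^-$ such that $(q,q^{-1})$ is an isomorphism onto the dual geometry $(X^-,X^+)$ and $x\top q(x)$ for some $x$. For a polarity $q$, the symmetric space $M^{(q)}$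 is the set $\{x\in X^+: x\top q(x)\}$ with multiplication $\mu(x,y)=(-1)_{x,q(x)}(y)$. The exchange automorphism of $\mathfrak g$ (which exchanges $V^+$ and $V^-$) induces the polarity $p:X^+\to X^-$ of $(V,T)$; in the charts it is $\mathrm{id}_V$. Denote by $(X_\alpha^+,X_\alpha^-;p_\alpha)$ the same objects for $(V,T_\alpha)$, and put $M_\alpha=M^{(p_\alpha)}\subset X_\alpha^+$. *Claim.* The homomorphism of Jordan pairs $(\mathrm{id},\alpha):(V_\alpha,V_\alpha)\to(V,V)$ induces a pair of maps $\Phi_\alpha=\Phi^+:X_\alpha^+\to X^+$, $\Phi^-:X^-_\alpha\to X^-$; that is, there is exactly one pair $(\Phi^+,\Phi^-)$ with $\Phi^\pm(o^\pm)=o^\pm$, $\Phi^\pm(\exp(v).z)=\exp(v).\Phi^\pm(z)$ for $v\in V_\alpha^+$ and $\Phi^\pm(\exp(a).z)=\exp(\alpha a).\Phi^\pm(z)$ for $a\in V_\alpha^-$. This pair is a homomorphism of geometries, $\Phi_\alpha$ is injective, and: 1. With $V\subset X^+$ via the chart, $\Phi_\alpha(M_\alpha)\cap V=\{x\in V: B(x,-\alpha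 x)\in\mathrm{GL}(V)\}$. 2. In the affine charts $\Phi_\alpha$ is the identity $V_\alpha\to V$, and its algebraic tangent map at the origin exists, is unique, and is the identity $V_\alpha\to V$. Here a linear map $L:V\to V$ is called an algebraic tangent map of $\Phi_\alpha$ at the origin if $(\Phi^+,\Phi^-)$ extends to the pair $(\Psi^+,\Psi^-)$ induced in the same way, over the dual numbers $K[\varepsilon]$, by the scalar extension of $(\mathrm{id},\alpha)$, and $\Psi^+(\varepsilon v)=\varepsilon L(v)$ for all $v\in V$ (in the charts $V\oplus\varepsilon V$). 3. If $\alpha$ is invertible, then, writing $\alpha$ also for the map $X^+\to X^+$ induced by the automorphism $(\alpha,\alpha^{-1})$ of the Jordan pair $(V,V)$, the map $p\circ\alpha:X^+\to X^-$ is a polarity, $\Phi_\alpha(M_\alpha)=M^{(p\circ\alpha)}$, and $\Phi_\alpha$ carries the multiplication of $M_\alpha$ to that of $M^{(p\circ\alpha)}$. -/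

import Mathlib

noncomputable section

set_option linter.unusedSectionVars false

namespace JordanPolar

universe u v

/-! ## Linear Jordan triple systems, homotopes, structural transformations -/

/-- A (linear) Jordan triple system on the `K`-module `V`: a trilinear map `T` with
`T(x,y,z) = T(z,y,x)` and
`T(u,v,T(x,y,z)) = T(T(u,v,x),y,z) - T(x,T(v,u,y),z) + T(x,y,T(u,v,z))`. -/
structure JTS (K : Type u) (V : Type v) [CommRing K] [AddCommGroup V] [Module K V] where
  tri : V →ₗ[K] V →ₗ[K] V →ₗ[K] V
  symm : ∀ x y z, tri x y z = tri z y x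
  jordan : ∀ p q x y z, tri p q (tri x y z) =
    tri (tri p q x) y z - tri x (tri q p y) z + tri x y (tri p q z)

section Basic

variable {K : Type u} {V : Type v} [CommRing K] [AddCommGroup V] [Module K V]

/-- The quadratic operator `Q(x) = ½ T(x, ·, x)`. -/
def JTS.Q [Invertible (2 : K)] (T : JTS K V) (x : V) : Module.End K V :=
  ⅟(2 : K) • (LinearMap.flip (T.tri x) x)

/-- The Bergman operator `B(x,y) = id - T(x,y) + Q(x) Q(y)`. -/
def JTS.B [Invertible (2 : K)] (T : JTS K V) (x y : V) : Module.End K V :=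
  1 - T.tri x y + T.Q x * T.Q y

/-- Structural transformations, i.e. the elements of the structure variety of `T`. -/
def JTS.IsStructural (T : JTS K V) (α : V →ₗ[K] V) : Prop :=
  ∀ x y z, T.tri (α x) y (α z) = α (T.tri x (α y) z)

/-- The `α`-homotope `T_α(x,y,z) = T(x, α y, z)`. -/
def JTS.homotope (T : JTS K V) (α : V →ₗ[K] V) (hα : T.IsStructural α) : JTS K V where
  tri := LinearMap.mk₂ K (fun x y => T.tri x (α y))
    (by intros; simp) (by intros; simp) (by intros; simp) (by intros; simp)
  symm x y z := T.symm x (α y) z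
  jordan p q x y z := by
    simp only [LinearMap.mk₂_apply]
    rw [T.jordan p (α q) x (α y) z, hα]

/-! ## The 3-graded Lie algebra of a Jordan triple system

The underlying Jordan pair of `T` is `(V⁺, V⁻) = (V, V)` with `T⁺ = T⁻ = T`. -/

/-- The derivations `(A⁺, A⁻)` of the Jordan pair `(V, V)`. -/
def JTS.Der (T : JTS K V) : Submodule K (Module.End K V × Module.End K V) where
  carrier := {A | (∀ x y z, A.1 (T.tri x y z) =
        T.tri (A.1 x) y z + T.tri x (A.2 y) z + T.tri x y (A.1 z)) ∧
      (∀ x y z, A.2 (T.tri x y z) =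
        T.tri (A.2 x) y z + T.tri x (A.1 y) z + T.tri x y (A.2 z))}
  zero_mem' := by simp
  add_mem' := by
    rintro A B ⟨hA, hA'⟩ ⟨hB, hB'⟩
    constructor <;> intro x y z
    · simp [hA, hB]; abel
    · simp [hA', hB']; abel
  smul_mem' := by
    rintro r A ⟨hA, hA'⟩
    constructor <;> intro x y z
    · simp [hA]
    · simp [hA']

/-- The commutator of two derivations. -/
def JTS.comm (T : JTS K V) (A B : T.Der) : T.Der :=
  ⟨A.1 * B.1 - B.1 * A.1, by
    obtain ⟨A, hA, hA'⟩ := A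
    obtain ⟨B, hB, hB'⟩ := B
    constructor <;> intro x y z
    · simp [hA, hB]; abel
    · simp [hA', hB']; abel⟩

/-- The inner derivation `D(x,a) = (T(x,a,·), -T(a,x,·))`. -/
def JTS.inner (T : JTS K V) (x a : V) : T.Der :=
  ⟨(T.tri x a, -T.tri a x), by
    constructor <;> intro u v w
    · simp [T.jordan x a u v w]; abel
    · simp [T.jordan a x u v w]; abel⟩

/-- The module `V⁺ ⊕ Der ⊕ V⁻` (degrees `1`, `0`, `-1`) underlying the 3-graded Lie algebra
of `T`. -/
def TKK (T : JTS K V) : Type v := V × T.Der × V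

instance (T : JTS K V) : AddCommGroup (TKK T) := inferInstanceAs (AddCommGroup (V × T.Der × V))
instance (T : JTS K V) : Module K (TKK T) := inferInstanceAs (Module K (V × T.Der × V))

namespace TKK

variable {T : JTS K V}

/-- The component in `V⁺`. -/
def pos (X : TKK T) : V := X.1
/-- The component in degree zero. -/
def zer (X : TKK T) : T.Der := X.2.1
/-- The component in `V⁻`. -/
def neg (X : TKK T) : V := X.2.2

/-- The element with given components. -/
def mk (x : V) (A : T.Der) (a : V) : TKK T := (x, A, a)

@[simp] theorem pos_mk (x : V) (A : T.Der) (a : V) : (mk x A a).pos = x := rfl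
@[simp] theorem zer_mk (x : V) (A : T.Der) (a : V) : (mk x A a).zer = A := rfl
@[simp] theorem neg_mk (x : V) (A : T.Der) (a : V) : (mk x A a).neg = a := rfl
@[simp] theorem pos_add (X Y : TKK T) : (X + Y).pos = X.pos + Y.pos := rfl
@[simp] theorem zer_add (X Y : TKK T) : (X + Y).zer = X.zer + Y.zer := rfl
@[simp] theorem neg_add (X Y : TKK T) : (X + Y).neg = X.neg + Y.neg := rfl
@[simp] theorem pos_smul (r : K) (X : TKK T) : (r • X).pos = r • X.pos := rfl
@[simp] theorem zer_smul (r : K) (X : TKK T) : (r • X).zer = r • X.zer := rfl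
@[simp] theorem neg_smul (r : K) (X : TKK T) : (r • X).neg = r • X.neg := rfl
@[simp] theorem pos_zero : (0 : TKK T).pos = 0 := rfl
@[simp] theorem zer_zero : (0 : TKK T).zer = 0 := rfl
@[simp] theorem neg_zero : (0 : TKK T).neg = 0 := rfl

theorem ext {X Y : TKK T} (h₁ : X.pos = Y.pos) (h₂ : X.zer.1.1 = Y.zer.1.1)
    (h₃ : X.zer.1.2 = Y.zer.1.2) (h₄ : X.neg = Y.neg) : X = Y :=
  Prod.ext h₁ (Prod.ext (Subtype.ext (Prod.ext h₂ h₃)) h₄)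

/-- The Lie bracket: derivations act on `V⁺` and `V⁻`, and `[x,a] = -D(x,a)` for
`x ∈ V⁺`, `a ∈ V⁻`, so that `[[x,a],z] = -T(x,a,z)` and `[[a,x],b] = -T(a,x,b)`. With this sign
`exp a`, for `a ∈ V⁻`, acts on the chart `V⁺` by the quasi-inverse
`x ↦ B(x,a)⁻¹ (x - Q(x)a)`. -/
instance : Bracket (TKK T) (TKK T) where
  bracket X Y := mk (X.zer.1.1 Y.pos - Y.zer.1.1 X.pos)
    (T.comm X.zer Y.zer - T.inner X.pos Y.neg + T.inner Y.pos X.neg)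
    (X.zer.1.2 Y.neg - Y.zer.1.2 X.neg)

@[simp] theorem pos_lie (X Y : TKK T) :
    (⁅X, Y⁆ : TKK T).pos = X.zer.1.1 Y.pos - Y.zer.1.1 X.pos := rfl
@[simp] theorem zer_lie (X Y : TKK T) :
    (⁅X, Y⁆ : TKK T).zer =
      T.comm X.zer Y.zer - T.inner X.pos Y.neg + T.inner Y.pos X.neg := rfl
@[simp] theorem neg_lie (X Y : TKK T) :
    (⁅X, Y⁆ : TKK T).neg = X.zer.1.2 Y.neg - Y.zer.1.2 X.neg := rfl

theorem comm_coe (A B : T.Der) : (T.comm A B).1 = A.1 * B.1 - B.1 * A.1 := rfl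
theorem inner_coe (x a : V) : (T.inner x a).1 = (T.tri x a, -T.tri a x) := rfl

instance : LieRing (TKK T) where
  add_lie X Y Z := by
    apply ext <;> simp [comm_coe, inner_coe, add_mul, mul_add] <;> abel
  lie_add X Y Z := by
    apply ext <;> simp [comm_coe, inner_coe, add_mul, mul_add] <;> abel
  lie_self X := by
    apply ext <;> simp [comm_coe]
  leibniz_lie X Y Z := by
    have h1 := fun (A : T.Der) => A.2.1
    have h2 := fun (A : T.Der) => A.2.2
    apply ext
    · simp [comm_coe, inner_coe]
      rw [T.symm X.pos Y.neg Z.pos, T.symm X.pos Z.neg Y.pos, T.symm Y.pos X.neg Z.pos]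
      abel
    · ext v
      simp [comm_coe, inner_coe, h1]; abel
    · ext v
      simp [comm_coe, inner_coe, h2]; abel
    · simp [comm_coe, inner_coe]
      rw [T.symm X.neg Y.pos Z.neg, T.symm X.neg Z.pos Y.neg, T.symm Y.neg X.pos Z.neg]
      abel

instance : LieAlgebra K (TKK T) where
  lie_smul r X Y := by
    apply ext <;> simp [comm_coe, inner_coe, smul_sub]

/-- The element `v ∈ V⁺` of the Lie algebra. -/
def vpos (T : JTS K V) (v : V) : TKK T := mk v 0 0
/-- The element `v ∈ V⁻` of the Lie algebra. -/
def vneg (T : JTS K V) (v : V) : TKK T := mk 0 0 v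

/-- The derivation defining the 3-grading: `i` times the identity in degree `i`. -/
def deg (T : JTS K V) : Module.End K (TKK T) where
  toFun X := mk X.pos 0 (-X.neg)
  map_add' X Y := by apply ext <;> simp [add_comm]
  map_smul' r X := by apply ext <;> simp

theorem deg_apply (X : TKK T) : deg T X = mk X.pos 0 (-X.neg) := rfl

theorem ad_vpos_cube (v : V) : (LieAlgebra.ad K (TKK T) (vpos T v)) ^ 3 = 0 := by
  ext1 X
  simp only [pow_succ, pow_zero, one_mul, Module.End.mul_apply, LieAlgebra.ad_apply,
    LinearMap.zero_apply]
  apply ext <;> simp [vpos, comm_coe, inner_coe]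

theorem ad_vneg_cube (v : V) : (LieAlgebra.ad K (TKK T) (vneg T v)) ^ 3 = 0 := by
  ext1 X
  simp only [pow_succ, pow_zero, one_mul, Module.End.mul_apply, LieAlgebra.ad_apply,
    LinearMap.zero_apply]
  apply ext <;> simp [vneg, comm_coe, inner_coe]

end TKK

/-! ## The projective elementary group and its geometry -/

section Geometry

open TKK

variable [Invertible (2 : K)]

/-- `1 + N + ½ N²`, the exponential of an operator with `N ^ 3 = 0`. -/
def expEnd {L : Type v} [AddCommGroup L] [Module K L] (N : Module.End K L) : Module.End K L :=
  1 + N + ⅟(2 : K) • (N * N)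

theorem expEnd_mul_neg {L : Type v} [AddCommGroup L] [Module K L] (N : Module.End K L)
    (h : N ^ 3 = 0) : expEnd N * expEnd (-N) = 1 := by
  have h3 : N * (N * N) = 0 := by rw [← h]; simp [pow_succ, mul_assoc]
  have h2 : ⅟(2 : K) • (N * N) + ⅟(2 : K) • (N * N) = N * N := by
    rw [← two_smul K, smul_smul, mul_invOf_self, one_smul]
  simp only [expEnd, mul_add, add_mul, mul_one, one_mul, smul_mul_assoc, mul_smul_comm,
    mul_neg, neg_mul, neg_neg, mul_assoc, h3, mul_zero, smul_zero, add_zero]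
  rw [show (1 + N + ⅟(2 : K) • (N * N) + -(N + N * N) + ⅟(2 : K) • (N * N) : Module.End K L)
    = 1 + ((⅟(2 : K) • (N * N) + ⅟(2 : K) • (N * N)) - N * N) by abel, h2]
  simp

/-- The exponential of an operator `N` with `N ^ 3 = 0`, as an automorphism. -/
def expEquiv {L : Type v} [AddCommGroup L] [Module K L] (N : Module.End K L) (h : N ^ 3 = 0) :
    L ≃ₗ[K] L :=
  LinearEquiv.ofLinearMap (expEnd N) (expEnd (-N)) (expEnd_mul_neg N h) (by
    have := expEnd_mul_neg (-N) (by rw [Odd.neg_pow (by decide), h, _root_.neg_zero])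
    rwa [neg_neg] at this)

/-- `exp (ad v)` for `v ∈ V⁺`. -/
def expPos (T : JTS K V) (v : V) : TKK T ≃ₗ[K] TKK T :=
  expEquiv (LieAlgebra.ad K (TKK T) (vpos T v)) (ad_vpos_cube v)

/-- `exp (ad v)` for `v ∈ V⁻`. -/
def expNeg (T : JTS K V) (v : V) : TKK T ≃ₗ[K] TKK T :=
  expEquiv (LieAlgebra.ad K (TKK T) (vneg T v)) (ad_vneg_cube v)

/-- The projective elementary group, generated by `exp V⁺` and `exp V⁻`. -/
def PE (T : JTS K V) : Subgroup (TKK T ≃ₗ[K] TKK T) :=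
  Subgroup.closure (Set.range (expPos T) ∪ Set.range (expNeg T))

/-- The translation `τ_v`, `v ∈ V⁺`, as an element of the projective elementary group. -/
def tau (T : JTS K V) (v : V) : PE T :=
  ⟨expPos T v, Subgroup.subset_closure (Or.inl ⟨v, rfl⟩)⟩

/-- The dual translation `τ̃_v`, `v ∈ V⁻`, as an element of the projective elementary group. -/
def tauTilde (T : JTS K V) (v : V) : PE T :=
  ⟨expNeg T v, Subgroup.subset_closure (Or.inr ⟨v, rfl⟩)⟩

/-- The structure group `H`: the elements of `PE` that are automorphisms of the 3-grading. -/
def strGroup (T : JTS K V) : Subgroup (PE T) where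
  carrier := {g | ∀ X, g.1 (deg T X) = deg T (g.1 X)}
  one_mem' X := rfl
  mul_mem' {a b} ha hb X := by
    change a.1 (b.1 _) = deg T (a.1 (b.1 X))
    rw [hb, ha]
  inv_mem' {a} ha X := by
    change a.1.symm _ = deg T (a.1.symm X)
    rw [LinearEquiv.symm_apply_eq, ha, LinearEquiv.apply_symm_apply]

/-- `P⁺ = U⁺ H`, where `U⁺ = exp V⁺` (which `H` normalizes). -/
def Pplus (T : JTS K V) : Subgroup (PE T) :=
  Subgroup.closure (Set.range (tau T)) ⊔ strGroup T

/-- `P⁻ = U⁻ H`, where `U⁻ = exp V⁻` (which `H` normalizes). -/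
def Pminus (T : JTS K V) : Subgroup (PE T) :=
  Subgroup.closure (Set.range (tauTilde T)) ⊔ strGroup T

/-- `X⁺ = PE / P⁻`. -/
abbrev Xp (T : JTS K V) : Type v := PE T ⧸ Pminus T

/-- `X⁻ = PE / P⁺`. -/
abbrev Xm (T : JTS K V) : Type v := PE T ⧸ Pplus T

/-- The base point `o⁺`. -/
def op (T : JTS K V) : Xp T := ((1 : PE T) : PE T ⧸ Pminus T)

/-- The base point `o⁻`. -/
def om (T : JTS K V) : Xm T := ((1 : PE T) : PE T ⧸ Pplus T)

/-- The affine chart `V⁺ → X⁺`, `v ↦ exp(v).o⁺`. -/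
def chartP (T : JTS K V) (v : V) : Xp T := tau T v • op T

/-- The affine chart `V⁻ → X⁻`, `v ↦ exp(v).o⁻`. -/
def chartM (T : JTS K V) (v : V) : Xm T := tauTilde T v • om T

/-- Transversality: `(x, a)` lies in the orbit of the base point `(o⁺, o⁻)`; equivalently, for
`a = g.o⁻`, the point `x` lies in the affine part `g.V⁺` of `X⁺`. -/
def Transv (T : JTS K V) (x : Xp T) (a : Xm T) : Prop :=
  ∃ g : PE T, g • op T = x ∧ g • om T = a

/-! ### Maps induced by automorphisms of the Lie algebra -/

theorem conj_expEquiv {T : JTS K V} (θ : TKK T ≃ₗ⁅K⁆ TKK T) (X : TKK T)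
    (h : (LieAlgebra.ad K (TKK T) X) ^ 3 = 0) (h' : (LieAlgebra.ad K (TKK T) (θ X)) ^ 3 = 0) :
    θ.toLinearEquiv * expEquiv _ h * θ.toLinearEquiv⁻¹ = expEquiv _ h' := by
  rw [mul_inv_eq_iff_eq_mul]
  ext1 Y
  change θ (Y + ⁅X, Y⁆ + ⅟(2 : K) • ⁅X, ⁅X, Y⁆⁆) =
    θ Y + ⁅θ X, θ Y⁆ + ⅟(2 : K) • ⁅θ X, ⁅θ X, θ Y⁆⁆
  simp only [← LieEquiv.map_lie, map_add, map_smul]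

/-- An automorphism of the Lie algebra that preserves the grading, and its effect on `V^±`. -/
structure Graded (T : JTS K V) where
  θ : TKK T ≃ₗ⁅K⁆ TKK T
  f : V → V
  g : V → V
  θ_pos : ∀ v, θ (vpos T v) = vpos T (f v)
  θ_neg : ∀ v, θ (vneg T v) = vneg T (g v)
  θ_deg : ∀ X, θ (deg T X) = deg T (θ X)

/-- An automorphism of the Lie algebra that reverses the grading, and its effect on `V^±`. -/
structure AntiGraded (T : JTS K V) where
  θ : TKK T ≃ₗ⁅K⁆ TKK T
  f : V → V
  g : V → V
  θ_pos : ∀ v, θ (vpos T v) = vneg T (f v)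
  θ_neg : ∀ v, θ (vneg T v) = vpos T (g v)
  θ_deg : ∀ X, θ (deg T X) = -deg T (θ X)

/-- Conjugation by an element normalizing `PE`. -/
def conjPE (T : JTS K V) (θ : TKK T ≃ₗ[K] TKK T) (h : ∀ g ∈ PE T, θ * g * θ⁻¹ ∈ PE T) :
    PE T →* PE T where
  toFun g := ⟨θ * g.1 * θ⁻¹, h g.1 g.2⟩
  map_one' := by ext1; simp
  map_mul' a b := by ext1; simp [mul_assoc]

theorem conj_mem_PE {T : JTS K V} (θ : TKK T ≃ₗ[K] TKK T)
    (h₁ : ∀ v, θ * expPos T v * θ⁻¹ ∈ PE T) (h₂ : ∀ v, θ * expNeg T v * θ⁻¹ ∈ PE T) :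
    ∀ g ∈ PE T, θ * g * θ⁻¹ ∈ PE T := by
  intro g hg
  have : PE T ≤ (PE T).comap (MulAut.conj θ).toMonoidHom := by
    refine (Subgroup.closure_le _).2 ?_
    rintro _ (⟨v, rfl⟩ | ⟨v, rfl⟩)
    · exact h₁ v
    · exact h₂ v
  exact this hg

/-- The map of quotients `g A ↦ φ(g) B` for a homomorphism `φ` with `φ(A) ⊆ B`. -/
def quotMap {G : Type v} [Group G] (φ : G →* G) (A B : Subgroup G) (h : A ≤ B.comap φ) :
    G ⧸ A → G ⧸ B :=
  Quotient.map' φ (by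
    intro a b hab
    rw [QuotientGroup.leftRel_apply] at hab ⊢
    have := h hab
    rwa [Subgroup.mem_comap, map_mul, map_inv] at this)

namespace Graded

variable {T : JTS K V} (c : Graded T)

theorem conj_pos (v : V) :
    c.θ.toLinearEquiv * expPos T v * c.θ.toLinearEquiv⁻¹ = expPos T (c.f v) := by
  have := conj_expEquiv c.θ (vpos T v) (ad_vpos_cube v)
    (by rw [c.θ_pos]; exact ad_vpos_cube _)
  simp only [c.θ_pos] at this
  exact this

theorem conj_neg (v : V) :
    c.θ.toLinearEquiv * expNeg T v * c.θ.toLinearEquiv⁻¹ = expNeg T (c.g v) := by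
  have := conj_expEquiv c.θ (vneg T v) (ad_vneg_cube v)
    (by rw [c.θ_neg]; exact ad_vneg_cube _)
  simp only [c.θ_neg] at this
  exact this

/-- The automorphism of `PE` induced by conjugation. -/
def conj : PE T →* PE T :=
  conjPE T c.θ.toLinearEquiv (conj_mem_PE _
    (fun v => by rw [conj_pos]; exact (tau T _).2)
    (fun v => by rw [conj_neg]; exact (tauTilde T _).2))

theorem conj_tau (v : V) : c.conj (tau T v) = tau T (c.f v) := Subtype.ext (c.conj_pos v)
theorem conj_tauTilde (v : V) : c.conj (tauTilde T v) = tauTilde T (c.g v) :=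
  Subtype.ext (c.conj_neg v)

theorem conj_strGroup : strGroup T ≤ (strGroup T).comap c.conj := by
  intro g hg X
  change c.θ (g.1 (c.θ.symm (deg T X))) = deg T (c.θ (g.1 (c.θ.symm X)))
  have : c.θ.symm (deg T X) = deg T (c.θ.symm X) := by
    apply c.θ.injective
    have := c.θ_deg (c.θ.symm X)
    rw [LieEquiv.apply_symm_apply] at this
    exact (c.θ.apply_symm_apply _).trans this.symm
  rw [this, hg, c.θ_deg]

/-- The induced map `X⁺ → X⁺`. -/
def mapP : Xp T → Xp T :=
  quotMap c.conj (Pminus T) (Pminus T) (sup_le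
    ((Subgroup.closure_le _).2 (by
      rintro _ ⟨v, rfl⟩
      change c.conj _ ∈ Pminus T
      rw [conj_tauTilde]
      exact Subgroup.mem_sup_left (Subgroup.subset_closure ⟨_, rfl⟩)))
    (c.conj_strGroup.trans (Subgroup.comap_mono le_sup_right)))

/-- The induced map `X⁻ → X⁻`. -/
def mapM : Xm T → Xm T :=
  quotMap c.conj (Pplus T) (Pplus T) (sup_le
    ((Subgroup.closure_le _).2 (by
      rintro _ ⟨v, rfl⟩
      change c.conj _ ∈ Pplus T
      rw [conj_tau]
      exact Subgroup.mem_sup_left (Subgroup.subset_closure ⟨_, rfl⟩)))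
    (c.conj_strGroup.trans (Subgroup.comap_mono le_sup_right)))

end Graded

namespace AntiGraded

variable {T : JTS K V} (c : AntiGraded T)

theorem conj_pos (v : V) :
    c.θ.toLinearEquiv * expPos T v * c.θ.toLinearEquiv⁻¹ = expNeg T (c.f v) := by
  have := conj_expEquiv c.θ (vpos T v) (ad_vpos_cube v)
    (by rw [c.θ_pos]; exact ad_vneg_cube _)
  simp only [c.θ_pos] at this
  exact this

theorem conj_neg (v : V) :
    c.θ.toLinearEquiv * expNeg T v * c.θ.toLinearEquiv⁻¹ = expPos T (c.g v) := by
  have := conj_expEquiv c.θ (vneg T v) (ad_vneg_cube v)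
    (by rw [c.θ_neg]; exact ad_vpos_cube _)
  simp only [c.θ_neg] at this
  exact this

/-- The automorphism of `PE` induced by conjugation. -/
def conj : PE T →* PE T :=
  conjPE T c.θ.toLinearEquiv (conj_mem_PE _
    (fun v => by rw [conj_pos]; exact (tauTilde T _).2)
    (fun v => by rw [conj_neg]; exact (tau T _).2))

theorem conj_tau (v : V) : c.conj (tau T v) = tauTilde T (c.f v) := Subtype.ext (c.conj_pos v)
theorem conj_tauTilde (v : V) : c.conj (tauTilde T v) = tau T (c.g v) :=
  Subtype.ext (c.conj_neg v)

theorem conj_strGroup : strGroup T ≤ (strGroup T).comap c.conj := by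
  intro g hg X
  change c.θ (g.1 (c.θ.symm (deg T X))) = deg T (c.θ (g.1 (c.θ.symm X)))
  have : c.θ.symm (deg T X) = -deg T (c.θ.symm X) := by
    apply c.θ.injective
    have := c.θ_deg (-c.θ.symm X)
    have h : c.θ (-c.θ.symm X) = -X :=
      (_root_.map_neg c.θ _).trans (congrArg Neg.neg (c.θ.apply_symm_apply X))
    rw [h, _root_.map_neg (deg T) (c.θ.symm X), _root_.map_neg (deg T) X, neg_neg] at this
    exact (c.θ.apply_symm_apply _).trans this.symm
  rw [this, _root_.map_neg, hg, _root_.map_neg, c.θ_deg, neg_neg]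

/-- The induced map `X⁺ → X⁻`. -/
def mapP : Xp T → Xm T :=
  quotMap c.conj (Pminus T) (Pplus T) (sup_le
    ((Subgroup.closure_le _).2 (by
      rintro _ ⟨v, rfl⟩
      change c.conj _ ∈ Pplus T
      rw [conj_tauTilde]
      exact Subgroup.mem_sup_left (Subgroup.subset_closure ⟨_, rfl⟩)))
    (c.conj_strGroup.trans (Subgroup.comap_mono le_sup_right)))

/-- The induced map `X⁻ → X⁺`. -/
def mapM : Xm T → Xp T :=
  quotMap c.conj (Pplus T) (Pminus T) (sup_le
    ((Subgroup.closure_le _).2 (by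
      rintro _ ⟨v, rfl⟩
      change c.conj _ ∈ Pminus T
      rw [conj_tau]
      exact Subgroup.mem_sup_left (Subgroup.subset_closure ⟨_, rfl⟩)))
    (c.conj_strGroup.trans (Subgroup.comap_mono le_sup_right)))

end AntiGraded

/-! ### Dilations, the polarity, and the action of invertible structural transformations -/

/-- The automorphism `(r, id, r⁻¹)` of the graded Lie algebra. -/
def scalingEquiv (T : JTS K V) (r : Kˣ) : TKK T ≃ₗ⁅K⁆ TKK T where
  toFun X := mk ((r : K) • X.pos) X.zer (((r⁻¹ : Kˣ) : K) • X.neg)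
  invFun X := mk (((r⁻¹ : Kˣ) : K) • X.pos) X.zer ((r : K) • X.neg)
  map_add' X Y := by apply ext <;> simp
  map_smul' s X := by
    apply ext
    · simp [smul_comm (r : K) s]
    · simp
    · simp
    · exact smul_comm _ _ _
  map_lie' {X Y} := by
    have h1 : ∀ v : V, (r : K) • ((r⁻¹ : Kˣ) : K) • v = v := fun v => by simp [smul_smul]
    have h2 : ∀ v : V, ((r⁻¹ : Kˣ) : K) • (r : K) • v = v := fun v => by simp [smul_smul]
    apply ext
    · simp [smul_sub]
    · ext v
      simp [comm_coe, inner_coe, h2]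
    · ext v
      simp [comm_coe, inner_coe, h1]
    · simp [smul_sub]
  left_inv X := by apply ext <;> simp [smul_smul]
  right_inv X := by apply ext <;> simp [smul_smul]

theorem scalingEquiv_apply (T : JTS K V) (r : Kˣ) (X : TKK T) :
    scalingEquiv T r X = mk ((r : K) • X.pos) X.zer (((r⁻¹ : Kˣ) : K) • X.neg) := rfl

/-- The automorphism `(r, id, r⁻¹)`, with its effect on `V^±`. -/
def scaling (T : JTS K V) (r : Kˣ) : Graded T where
  θ := scalingEquiv T r
  f v := (r : K) • v
  g v := ((r⁻¹ : Kˣ) : K) • v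
  θ_pos v := by rw [scalingEquiv_apply]; apply ext <;> simp [vpos]
  θ_neg v := by rw [scalingEquiv_apply]; apply ext <;> simp [vneg]
  θ_deg X := by simp only [scalingEquiv_apply, deg_apply]; apply ext <;> simp

/-- The exchange automorphism of the Lie algebra, induced by the exchange `V⁺ = V = V⁻`. -/
def exchangeEquiv (T : JTS K V) : TKK T ≃ₗ⁅K⁆ TKK T where
  toFun X := mk X.neg ⟨(X.zer.1.2, X.zer.1.1), X.zer.2.2, X.zer.2.1⟩ X.pos
  invFun X := mk X.neg ⟨(X.zer.1.2, X.zer.1.1), X.zer.2.2, X.zer.2.1⟩ X.pos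
  map_add' X Y := by apply ext <;> simp
  map_smul' s X := by apply ext <;> simp
  map_lie' {X Y} := by
    apply ext <;> simp [comm_coe, inner_coe] <;> abel
  left_inv X := by apply ext <;> simp
  right_inv X := by apply ext <;> simp

theorem exchangeEquiv_apply (T : JTS K V) (X : TKK T) : exchangeEquiv T X =
    mk X.neg ⟨(X.zer.1.2, X.zer.1.1), X.zer.2.2, X.zer.2.1⟩ X.pos := rfl

/-- The exchange automorphism, with its effect on `V^±`. -/
def exchange (T : JTS K V) : AntiGraded T where
  θ := exchangeEquiv T
  f v := v
  g v := v
  θ_pos v := by rw [exchangeEquiv_apply]; apply ext <;> simp [vpos, vneg]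
  θ_neg v := by rw [exchangeEquiv_apply]; apply ext <;> simp [vpos, vneg]
  θ_deg X := by
    simp only [exchangeEquiv_apply, deg_apply]
    rw [eq_neg_iff_add_eq_zero]
    apply ext <;> simp

/-- The polarity `p : X⁺ → X⁻` of the geometry of `T`, induced by the exchange automorphism;
on the charts it is the identification `V⁺ = V = V⁻`. -/
def pol (T : JTS K V) : Xp T → Xm T := (exchange T).mapP

theorem strAut_aux {T : JTS K V} {β : V ≃ₗ[K] V} (hβ : T.IsStructural β.toLinearMap) (x y z : V) :
    T.tri (β x) (β.symm y) (β z) = β (T.tri x y z) := by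
  simpa using hβ x (β.symm y) z

theorem strAut_aux' {T : JTS K V} {β : V ≃ₗ[K] V} (hβ : T.IsStructural β.toLinearMap)
    (x y z : V) : T.tri (β.symm x) (β y) (β.symm z) = β.symm (T.tri x y z) := by
  apply β.injective
  simpa using (hβ (β.symm x) y (β.symm z)).symm

/-- The conjugate of a derivation by an automorphism `(β, γ)`, `γ = β⁻¹`, of `(V, V)`. -/
def conjDer (T : JTS K V) (β : V ≃ₗ[K] V)
    (h : ∀ x y z, T.tri (β x) (β.symm y) (β z) = β (T.tri x y z))
    (h' : ∀ x y z, T.tri (β.symm x) (β y) (β.symm z) = β.symm (T.tri x y z)) (A : T.Der) : T.Der :=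
  ⟨(β.toLinearMap * A.1.1 * β.symm.toLinearMap, β.symm.toLinearMap * A.1.2 * β.toLinearMap), by
    constructor <;> intro x y z
    · have := congrArg β (A.2.1 (β.symm x) (β y) (β.symm z))
      simpa [h', ← h] using this
    · have := congrArg β.symm (A.2.2 (β x) (β.symm y) (β z))
      simpa [h, ← h'] using this⟩

theorem conjDer_coe (T : JTS K V) (β : V ≃ₗ[K] V) (h h') (A : T.Der) :
    (conjDer T β h h' A).1 =
      (β.toLinearMap * A.1.1 * β.symm.toLinearMap, β.symm.toLinearMap * A.1.2 * β.toLinearMap) :=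
  rfl

/-- The automorphism of the Lie algebra induced by the automorphism `(β, β⁻¹)` of the
Jordan pair `(V, V)`, for an invertible structural transformation `β`. -/
def strEquiv (T : JTS K V) (β : V ≃ₗ[K] V) (hβ : T.IsStructural β.toLinearMap) :
    TKK T ≃ₗ⁅K⁆ TKK T where
  toFun X := mk (β X.pos) (conjDer T β (strAut_aux hβ) (strAut_aux' hβ) X.zer) (β.symm X.neg)
  invFun X := mk (β.symm X.pos)
    (conjDer T β.symm (strAut_aux' hβ) (strAut_aux hβ) X.zer) (β X.neg)
  map_add' X Y := by apply ext <;> simp [conjDer_coe, mul_add, add_mul]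
  map_smul' s X := by apply ext <;> simp [conjDer_coe]
  map_lie' {X Y} := by
    apply ext
    · simp [conjDer_coe]
    · ext v
      simp [comm_coe, inner_coe, conjDer_coe, ← strAut_aux hβ]
    · ext v
      simp [comm_coe, inner_coe, conjDer_coe, ← strAut_aux' hβ]
    · simp [conjDer_coe]
  left_inv X := by
    apply ext <;> simp [conjDer_coe, LinearMap.ext_iff]
  right_inv X := by
    apply ext <;> simp [conjDer_coe, LinearMap.ext_iff]

theorem strEquiv_apply (T : JTS K V) (β : V ≃ₗ[K] V) (hβ : T.IsStructural β.toLinearMap)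
    (X : TKK T) : strEquiv T β hβ X =
      mk (β X.pos) (conjDer T β (strAut_aux hβ) (strAut_aux' hβ) X.zer) (β.symm X.neg) := rfl

/-- The automorphism induced by `(β, β⁻¹)`, with its effect on `V^±`. -/
def strAut (T : JTS K V) (β : V ≃ₗ[K] V) (hβ : T.IsStructural β.toLinearMap) : Graded T where
  θ := strEquiv T β hβ
  f := β
  g := β.symm
  θ_pos v := by rw [strEquiv_apply]; apply ext <;> simp [conjDer_coe, vpos]
  θ_neg v := by rw [strEquiv_apply]; apply ext <;> simp [conjDer_coe, vneg]
  θ_deg X := by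
    simp only [strEquiv_apply, deg_apply]
    apply ext <;> simp [conjDer_coe]

/-- The composition `p ∘ β : X⁺ → X⁻` of the polarity `p` with the extension of the invertible
structural transformation `β` to `X⁺`; on the charts it is `β : V⁺ → V⁻`. -/
def polComp (T : JTS K V) (β : V ≃ₗ[K] V) (hβ : T.IsStructural β.toLinearMap) : Xp T → Xm T :=
  pol T ∘ (strAut T β hβ).mapP

/-! ### Structure maps, homomorphisms, polarities, symmetric spaces

The affine structure of the affine part `a^⊤` of `X⁺`, for `a = g.o⁻`, is transported by
`v ↦ g.exp(v).o⁺` from `V⁺`; dually for `X⁻`. The structure maps are described by their graphs. -/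

/-- `z = Π_r(x,a,y)`: for `x, y` in the affine part of `a`, the point `z` is `r y` in the module
with underlying set the affine part of `a` and zero vector `x`. -/
def PiP (T : JTS K V) (r : K) (x : Xp T) (a : Xm T) (y z : Xp T) : Prop :=
  ∃ (g : PE T) (u : V), g • op T = x ∧ g • om T = a ∧ g • chartP T u = y ∧
    g • chartP T (r • u) = z

/-- `c = Π_r(a,x,b)`, dual to `PiP`. -/
def PiM (T : JTS K V) (r : K) (a : Xm T) (x : Xp T) (b c : Xm T) : Prop :=
  ∃ (g : PE T) (u : V), g • op T = x ∧ g • om T = a ∧ g • chartM T u = b ∧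
    g • chartM T (r • u) = c

/-- `w = Σ(x,a,y,z)`: the sum `y + z` in the affine part of `a` with zero vector `x`. -/
def SigmaP (T : JTS K V) (x : Xp T) (a : Xm T) (y z w : Xp T) : Prop :=
  ∃ (g : PE T) (u v : V), g • op T = x ∧ g • om T = a ∧ g • chartP T u = y ∧
    g • chartP T v = z ∧ g • chartP T (u + v) = w

/-- `d = Σ(a,x,b,c)`, dual to `SigmaP`. -/
def SigmaM (T : JTS K V) (a : Xm T) (x : Xp T) (b c d : Xm T) : Prop :=
  ∃ (g : PE T) (u v : V), g • op T = x ∧ g • om T = a ∧ g • chartM T u = b ∧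
    g • chartM T v = c ∧ g • chartM T (u + v) = d

/-- `z = r_{x,a}(y)` for an invertible scalar `r`, a transversal pair `(x,a)` and an arbitrary
`y ∈ X⁺`: the extension of the dilation `Π_r(x,a,·)` to an automorphism of the geometry. -/
def DilP (T : JTS K V) (r : Kˣ) (x : Xp T) (a : Xm T) (y z : Xp T) : Prop :=
  ∃ g : PE T, g • op T = x ∧ g • om T = a ∧ g • (scaling T r).mapP (g⁻¹ • y) = z

/-- `c = r_{a,x}(b)`, dual to `DilP`. -/
def DilM (T : JTS K V) (r : Kˣ) (a : Xm T) (x : Xp T) (b c : Xm T) : Prop :=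
  ∃ g : PE T, g • op T = x ∧ g • om T = a ∧ g • (scaling T r⁻¹).mapM (g⁻¹ • b) = c

/-- Homomorphisms of geometries: pairs of maps compatible with transversality and with the
structure maps. -/
structure IsHom (T T' : JTS K V) (Φp : Xp T → Xp T') (Φm : Xm T → Xm T') : Prop where
  transv : ∀ x a, Transv T x a → Transv T' (Φp x) (Φm a)
  piP : ∀ r x a y z, PiP T r x a y z → PiP T' r (Φp x) (Φm a) (Φp y) (Φp z)
  piM : ∀ r a x b c, PiM T r a x b c → PiM T' r (Φm a) (Φp x) (Φm b) (Φm c)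
  sigmaP : ∀ x a y z w, SigmaP T x a y z w → SigmaP T' (Φp x) (Φm a) (Φp y) (Φp z) (Φp w)
  sigmaM : ∀ a x b c d, SigmaM T a x b c d → SigmaM T' (Φm a) (Φp x) (Φm b) (Φm c) (Φm d)
  dilP : ∀ r x a y z, DilP T r x a y z → DilP T' r (Φp x) (Φm a) (Φp y) (Φp z)
  dilM : ∀ r a x b c, DilM T r a x b c → DilM T' r (Φm a) (Φp x) (Φm b) (Φm c)

/-- Polarities: bijections `q : X⁺ → X⁻` such that `(q, q⁻¹)` is an isomorphism onto the dual
geometry, having a non-isotropic point. -/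
def IsPolarity (T : JTS K V) (q : Xp T → Xm T) : Prop :=
  (∃ q' : Xm T → Xp T, Function.LeftInverse q' q ∧ Function.RightInverse q' q ∧
    (∀ x a, Transv T x a ↔ Transv T (q' a) (q x)) ∧
    (∀ r x a y z, PiP T r x a y z ↔ PiM T r (q x) (q' a) (q y) (q z)) ∧
    (∀ r a x b c, PiM T r a x b c ↔ PiP T r (q' a) (q x) (q' b) (q' c)) ∧
    (∀ x a y z w, SigmaP T x a y z w ↔ SigmaM T (q x) (q' a) (q y) (q z) (q w)) ∧
    (∀ a x b c d, SigmaM T a x b c d ↔ SigmaP T (q' a) (q x) (q' b) (q' c) (q' d)) ∧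
    (∀ r x a y z, DilP T r x a y z ↔ DilM T r (q x) (q' a) (q y) (q z)) ∧
    (∀ r a x b c, DilM T r a x b c ↔ DilP T r (q' a) (q x) (q' b) (q' c))) ∧
  ∃ x, Transv T x (q x)

/-- The set `M^(q) = {x ∈ X⁺ | x ⊤ q(x)}` of non-isotropic points of `q`. -/
def symSpace (T : JTS K V) (q : Xp T → Xm T) : Set (Xp T) := {x | Transv T x (q x)}

/-- `z = μ(x,y) = (-1)_{x,q(x)}(y)`, the multiplication of the symmetric space `M^(q)`. -/
def symMul (T : JTS K V) (q : Xp T → Xm T) (x y z : Xp T) : Prop := DilP T (-1) x (q x) y z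

end Geometry

end Basic

/-! ### Maps of geometries induced by maps of Jordan pairs -/

section Induced

variable {K : Type u} {V : Type v} [CommRing K] [AddCommGroup V] [Module K V] [Invertible (2 : K)]
variable {K' : Type u} {V' : Type v} [CommRing K'] [AddCommGroup V'] [Module K' V']
  [Invertible (2 : K')]

/-- The pair `(Φ⁺, Φ⁻)` is induced by the pair of maps `(f⁺ : V⁺ → V'⁺, f⁻ : V⁻ → V'⁻)`:
`Φ^±` sends `g₁ ⋯ gₙ.o^±`, where each `gᵢ` is `exp v` for some `v` in `V⁺` or `V⁻`, to
`g₁' ⋯ gₙ'.o^±`, where `gᵢ'` is `exp f⁺(v)` or `exp f⁻(v)`. -/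
structure InducedBy (T : JTS K V) (T' : JTS K' V') (fp fm : V → V')
    (Φp : Xp T → Xp T') (Φm : Xm T → Xm T') : Prop where
  base_p : Φp (op T) = op T'
  base_m : Φm (om T) = om T'
  tau_p : ∀ v x, Φp (tau T v • x) = tau T' (fp v) • Φp x
  tauTilde_p : ∀ v x, Φp (tauTilde T v • x) = tauTilde T' (fm v) • Φp x
  tau_m : ∀ v a, Φm (tau T v • a) = tau T' (fp v) • Φm a
  tauTilde_m : ∀ v a, Φm (tauTilde T v • a) = tauTilde T' (fm v) • Φm a

end Induced

/-! ### Scalar extension by dual numbers and algebraic tangent maps -/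

section Dual

variable {K : Type u} {V : Type v} [CommRing K] [AddCommGroup V] [Module K V]

/-- The scalar extension `V[ε] = V ⊕ ε V`; the pair `(x, y)` stands for `x + ε y`. -/
def DualExt (V : Type v) : Type v := V × V

instance : AddCommGroup (DualExt V) := inferInstanceAs (AddCommGroup (V × V))

namespace DualExt

/-- `x + ε y`. -/
def mk (x y : V) : DualExt V := (x, y)
/-- The part without `ε`. -/
def re (w : DualExt V) : V := w.1
/-- The coefficient of `ε`. -/
def im (w : DualExt V) : V := w.2

@[simp] theorem re_mk (x y : V) : (mk x y).re = x := rfl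
@[simp] theorem im_mk (x y : V) : (mk x y).im = y := rfl
@[simp] theorem re_add (w z : DualExt V) : (w + z).re = w.re + z.re := rfl
@[simp] theorem im_add (w z : DualExt V) : (w + z).im = w.im + z.im := rfl
@[simp] theorem re_sub (w z : DualExt V) : (w - z).re = w.re - z.re := rfl
@[simp] theorem im_sub (w z : DualExt V) : (w - z).im = w.im - z.im := rfl
@[simp] theorem re_zero : (0 : DualExt V).re = 0 := rfl
@[simp] theorem im_zero : (0 : DualExt V).im = 0 := rfl

theorem ext {w z : DualExt V} (h₁ : w.re = z.re) (h₂ : w.im = z.im) : w = z := Prod.ext h₁ h₂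

/-- `(r + ε s)(x + ε y) = r x + ε (r y + s x)`. -/
instance : SMul (DualNumber K) (DualExt V) where
  smul r w := mk (r.fst • w.re) (r.fst • w.im + r.snd • w.re)

@[simp] theorem re_smul (r : DualNumber K) (w : DualExt V) : (r • w).re = r.fst • w.re := rfl
@[simp] theorem im_smul (r : DualNumber K) (w : DualExt V) :
    (r • w).im = r.fst • w.im + r.snd • w.re := rfl

instance : Module (DualNumber K) (DualExt V) where
  one_smul w := by apply ext <;> simp
  mul_smul r s w := by
    apply ext
    · simp [mul_smul]
    · simp [mul_smul, add_smul]; abel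
  smul_zero r := by apply ext <;> simp
  smul_add r w z := by apply ext <;> simp; abel
  add_smul r s w := by apply ext <;> simp [add_smul]; abel
  zero_smul w := by apply ext <;> simp

/-- The scalar extension of a linear map. -/
def map (α : V →ₗ[K] V) : DualExt V →ₗ[DualNumber K] DualExt V where
  toFun w := mk (α w.re) (α w.im)
  map_add' w z := by apply ext <;> simp
  map_smul' r w := by apply ext <;> simp

@[simp] theorem re_map (α : V →ₗ[K] V) (w : DualExt V) : (map α w).re = α w.re := rfl
@[simp] theorem im_map (α : V →ₗ[K] V) (w : DualExt V) : (map α w).im = α w.im := rfl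

end DualExt

open DualExt

/-- The scalar extension of a Jordan triple system by dual numbers. -/
def JTS.dual (T : JTS K V) : JTS (DualNumber K) (DualExt V) where
  tri := LinearMap.mk₂ (DualNumber K) (fun x y =>
      { toFun := fun z => DualExt.mk (T.tri x.re y.re z.re)
          (T.tri x.im y.re z.re + T.tri x.re y.im z.re + T.tri x.re y.re z.im)
        map_add' := fun z w => by apply DualExt.ext <;> simp; abel
        map_smul' := fun r z => by apply DualExt.ext <;> simp; abel })
    (fun x x' y => by ext1 z; apply DualExt.ext <;> simp; abel)
    (fun r x y => by ext1 z; apply DualExt.ext <;> simp; abel)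
    (fun x y y' => by ext1 z; apply DualExt.ext <;> simp; abel)
    (fun r x y => by ext1 z; apply DualExt.ext <;> simp; abel)
  symm x y z := by
    apply DualExt.ext
    · simp [T.symm x.re y.re z.re]
    · simp [T.symm x.re _ z.re, T.symm x.im _ z.re, T.symm x.re _ z.im]; abel
  jordan p q x y z := by
    apply DualExt.ext
    · simp [T.jordan p.re q.re x.re y.re z.re]
    · simp [T.jordan p.re q.re, T.jordan p.im q.re, T.jordan p.re q.im]; abel

theorem JTS.dual_apply (T : JTS K V) (x y z : DualExt V) : T.dual.tri x y z =
    DualExt.mk (T.tri x.re y.re z.re)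
      (T.tri x.im y.re z.re + T.tri x.re y.im z.re + T.tri x.re y.re z.im) := rfl

theorem JTS.IsStructural.dual {T : JTS K V} {α : V →ₗ[K] V} (h : T.IsStructural α) :
    T.dual.IsStructural (DualExt.map α) := by
  intro x y z
  apply DualExt.ext
  · simp [JTS.dual_apply, h _ _ _]
  · simp [JTS.dual_apply, h _ _ _]

instance [Invertible (2 : K)] : Invertible (2 : DualNumber K) where
  invOf := TrivSqZeroExt.inl ⅟(2 : K)
  invOf_mul_self := by
    have : (2 : DualNumber K) = TrivSqZeroExt.inl 2 := rfl
    rw [this, ← TrivSqZeroExt.inl_mul, invOf_mul_self, TrivSqZeroExt.inl_one]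
  mul_invOf_self := by
    have : (2 : DualNumber K) = TrivSqZeroExt.inl 2 := rfl
    rw [this, ← TrivSqZeroExt.inl_mul, mul_invOf_self, TrivSqZeroExt.inl_one]

variable [Invertible (2 : K)]

/-- `L` is the algebraic tangent map at the origin of the map `Φ⁺` from the geometry of the
homotope `T_α` to that of `T`: the pair `(Φ⁺, Φ⁻)` extends, over the dual numbers, to the pair
`(Ψ⁺, Ψ⁻)` induced by the scalar extension of `(id, α)`, and `Ψ⁺(ε v) = ε L(v)` in the affine
charts. Here `ι`, `κ` are the inclusions of the geometries into their scalar extensions. -/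
def IsTangentMap (T : JTS K V) (α : V →ₗ[K] V) (hα : T.IsStructural α)
    (Φp : Xp (T.homotope α hα) → Xp T) (Φm : Xm (T.homotope α hα) → Xm T) (L : V →ₗ[K] V) : Prop :=
  ∃ (ιp : Xp (T.homotope α hα) → Xp (T.dual.homotope (DualExt.map α) hα.dual))
    (ιm : Xm (T.homotope α hα) → Xm (T.dual.homotope (DualExt.map α) hα.dual))
    (κp : Xp T → Xp T.dual) (κm : Xm T → Xm T.dual)
    (Ψp : Xp (T.dual.homotope (DualExt.map α) hα.dual) → Xp T.dual)
    (Ψm : Xm (T.dual.homotope (DualExt.map α) hα.dual) → Xm T.dual),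
    InducedBy (T.homotope α hα) (T.dual.homotope (DualExt.map α) hα.dual)
      (fun v => DualExt.mk v 0) (fun v => DualExt.mk v 0) ιp ιm ∧
    InducedBy T T.dual (fun v => DualExt.mk v 0) (fun v => DualExt.mk v 0) κp κm ∧
    InducedBy (T.dual.homotope (DualExt.map α) hα.dual) T.dual id (DualExt.map α) Ψp Ψm ∧
    (∀ x, Ψp (ιp x) = κp (Φp x)) ∧ (∀ a, Ψm (ιm a) = κm (Φm a)) ∧
    ∀ v, Ψp (chartP _ (DualExt.mk 0 v)) = chartP T.dual (DualExt.mk 0 (L v))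

end Dual

end JordanPolar
end

noncomputable section

namespace JordanPolar

universe u v

open TKK

/-! ## The Euler element and the action of the projective elementary group -/

section Euler

variable {K : Type u} {V : Type v} [CommRing K] [AddCommGroup V] [Module K V]

/-! The adjoint action of the Euler element E = (id, -id) is the grading. As 2 and 3 are invertible,
the projective elementary group acts by Lie algebra automorphisms, so stabilizers can be read off
from E: H is the stabilizer of E, and P⁻ consists of the g with gE - E in V⁻ (`mem_strGroup_iff`,
`Pminus_apply`, `mem_Pminus_of_euler`).

A homomorphism of Jordan pairs need not extend to derivations, so it gives no map of Lie algebras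
and no evident group homomorphism. Instead words are related letter by letter (`wordRel`), and Lie
algebra elements by `Related`. The induced maps are well defined because words related to elements
of P^± stay in P^±. This reduces to H, where a related word sends E to E + z with z of degree zero
and centralized by all letters that occur. Every conjugate F of E satisfies (ad F)³ = ad F; applied
to E + z and E - z this forces z = 0 (`mem_strGroup_of_wordRel`). Uniqueness and the homomorphism
property come from carrying words across.

Injectivity is the delicate point, since α may have a kernel: if the word related to g lies in P⁻,
the identity on V⁺ only shows that gE and E agree in degree one and in their action on V⁺. The
remaining error N on V⁻ takes values in the elements of V⁻ acting trivially on V⁺. These generate an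
invariant subspace in degrees -1 and 0, where polynomial identities obtained from g and g⁻¹ force N
= 0 (`mem_Pminus_of_pos_zer`).

The same criterion shows that x ⊤ a holds in the charts exactly when B(x,-a) is invertible
(`transv_chart_iff`); with B_α(x,-x) = B(x,-αx) and injectivity this is (1). Claim (2) follows from
uniqueness of induced maps and injectivity of the chart over the dual numbers. For (3), (id, α⁻¹)
induces the inverse map, and Φ intertwines the two polarities (`InducedBy.polComp`). -/

/-- The Euler element: the derivation `(id, -id)`, whose adjoint action is the grading. -/
def euler (T : JTS K V) : TKK T :=
  mk 0 ⟨(1, -1), by constructor <;> intro x y z <;> simp⟩ 0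

variable {T : JTS K V}

@[simp] theorem pos_euler : (euler T).pos = 0 := rfl
@[simp] theorem neg_euler : (euler T).neg = 0 := rfl
@[simp] theorem zer_euler_fst : (euler T).zer.1.1 = 1 := rfl
@[simp] theorem zer_euler_snd : (euler T).zer.1.2 = -1 := rfl

@[simp] theorem pos_vpos (v : V) : (vpos T v).pos = v := rfl
@[simp] theorem zer_vpos (v : V) : (vpos T v).zer = 0 := rfl
@[simp] theorem neg_vpos (v : V) : (vpos T v).neg = 0 := rfl
@[simp] theorem pos_vneg (v : V) : (vneg T v).pos = 0 := rfl
@[simp] theorem zer_vneg (v : V) : (vneg T v).zer = 0 := rfl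
@[simp] theorem neg_vneg (v : V) : (vneg T v).neg = v := rfl
@[simp] theorem pos_neg (X : TKK T) : (-X).pos = -X.pos := rfl
@[simp] theorem zer_neg (X : TKK T) : (-X).zer = -X.zer := rfl
@[simp] theorem neg_neg' (X : TKK T) : (-X).neg = -X.neg := rfl
@[simp] theorem pos_sub (X Y : TKK T) : (X - Y).pos = X.pos - Y.pos := rfl
@[simp] theorem zer_sub (X Y : TKK T) : (X - Y).zer = X.zer - Y.zer := rfl
@[simp] theorem neg_sub' (X Y : TKK T) : (X - Y).neg = X.neg - Y.neg := rfl

theorem vpos_neg (v : V) : vpos T (-v) = -vpos T v := by apply ext <;> simp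
theorem vneg_neg (v : V) : vneg T (-v) = -vneg T v := by apply ext <;> simp
theorem vneg_add (v w : V) : vneg T (v + w) = vneg T v + vneg T w := by apply ext <;> simp

theorem deg_eq_lie (X : TKK T) : deg T X = ⁅euler T, X⁆ := by
  rw [deg_apply]
  apply ext <;> simp [comm_coe, inner_coe]

theorem euler_lie_lie_lie (X : TKK T) :
    ⁅euler T, ⁅euler T, ⁅euler T, X⁆⁆⁆ = ⁅euler T, X⁆ := by
  apply ext <;> simp [comm_coe, inner_coe]

/-- Brackets with V⁺ and V⁻ detect the two halves of the degree-zero part, and the bracket with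
`euler` detects the other degrees. Hence commuting with the grading amounts to fixing `euler`. -/
theorem eq_euler_of_lie_eq_deg {F : TKK T} (h : ∀ X, ⁅F, X⁆ = deg T X) : F = euler T := by
  have hp : ∀ v, ⁅F, vpos T v⁆ = deg T (vpos T v) := fun v => h _
  have hn : ∀ v, ⁅F, vneg T v⁆ = deg T (vneg T v) := fun v => h _
  have he := h (euler T)
  apply ext
  · simpa [deg_apply] using congrArg pos he
  · ext v
    simpa [deg_apply] using congrArg pos (hp v)
  · ext v
    simpa [deg_apply] using congrArg neg (hn v)
  · simpa [deg_apply] using congrArg neg he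

theorem two_smul_eq_zero [Invertible (2 : K)] {M : Type*} [AddCommGroup M] [Module K M] {x : M}
    (h : (2 : ℤ) • x = 0) : x = 0 := by
  have h' : (2 : K) • x = 0 := by rw [← h, two_smul, two_smul]
  rw [← one_smul K x, ← invOf_mul_self (2 : K), mul_smul, h', smul_zero]

theorem three_smul_eq_zero (h3 : IsUnit (3 : K)) {M : Type*} [AddCommGroup M] [Module K M] {x : M}
    (h : (3 : ℤ) • x = 0) : x = 0 := by
  refine (h3.smul_eq_zero (x := x)).1 ?_
  rw [← h, ← Int.cast_smul_eq_zsmul K]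
  norm_num

/-! ### Exponentials as Lie algebra automorphisms -/

variable [Invertible (2 : K)]

/-- The Leibniz expansion of (ad X)³[Y,Z] = 0 is three times the cubic defect, and applying ad X to
that defect gives twice the quartic one. This is where 3 must be invertible. -/
theorem expEnd_ad_lie (h3 : IsUnit (3 : K)) {L : Type v} [LieRing L] [LieAlgebra K L] (X : L)
    (h : (LieAlgebra.ad K L X) ^ 3 = 0) (Y Z : L) :
    expEnd (LieAlgebra.ad K L X) ⁅Y, Z⁆ =
      ⁅expEnd (LieAlgebra.ad K L X) Y, expEnd (LieAlgebra.ad K L X) Z⁆ := by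
  have h0 : ∀ W : L, ⁅X, ⁅X, ⁅X, W⁆⁆⁆ = 0 := fun W => by
    simpa [pow_succ] using LinearMap.congr_fun h W
  have key : ⁅⁅X, ⁅X, Y⁆⁆, ⁅X, Z⁆⁆ + ⁅⁅X, Y⁆, ⁅X, ⁅X, Z⁆⁆⁆ = 0 := by
    apply three_smul_eq_zero h3
    have := h0 ⁅Y, Z⁆
    simp only [leibniz_lie X Y Z, leibniz_lie X ⁅X, _⁆ _, leibniz_lie X Y ⁅X, _⁆, lie_add, h0,
      zero_lie, lie_zero] at this
    rw [← this]
    abel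
  have key2 : ⁅⁅X, ⁅X, Y⁆⁆, ⁅X, ⁅X, Z⁆⁆⁆ = 0 := by
    apply two_smul_eq_zero (K := K)
    have := congrArg (fun W => ⁅X, W⁆) key
    simp only [lie_add, leibniz_lie X ⁅X, _⁆ ⁅X, _⁆, h0, zero_lie, lie_zero] at this
    rw [← this]
    abel
  have half : ∀ W : L, W = ⅟(2 : K) • W + ⅟(2 : K) • W := fun W => by
    rw [← add_smul, invOf_two_add_invOf_two, one_smul]
  change ⁅Y, Z⁆ + ⁅X, ⁅Y, Z⁆⁆ + ⅟(2 : K) • ⁅X, ⁅X, ⁅Y, Z⁆⁆⁆ =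
    ⁅Y + ⁅X, Y⁆ + ⅟(2 : K) • ⁅X, ⁅X, Y⁆⁆, Z + ⁅X, Z⁆ + ⅟(2 : K) • ⁅X, ⁅X, Z⁆⁆⁆
  simp only [add_lie, lie_add, smul_lie, lie_smul, key2, smul_zero, leibniz_lie X Y Z,
    leibniz_lie X ⁅X, _⁆ Z, leibniz_lie X Y ⁅X, _⁆, smul_add]
  have k := congrArg (fun W => ⅟(2 : K) • W) key
  simp only [smul_add, smul_zero] at k
  -- The mixed term [[X,Y],[X,Z]] arises as two halves on the left, so it is split on the right.
  conv_rhs => rw [half ⁅⁅X, Y⁆, ⁅X, Z⁆⁆]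
  rw [eq_neg_of_add_eq_zero_left k]
  abel

theorem PE_lie (h3 : IsUnit (3 : K)) (g : PE T) (X Y : TKK T) :
    g.1 ⁅X, Y⁆ = ⁅g.1 X, g.1 Y⁆ := by
  have : ∀ g ∈ PE T, ∀ X Y : TKK T, g ⁅X, Y⁆ = ⁅g X, g Y⁆ := by
    intro g hg
    induction hg using Subgroup.closure_induction with
    | mem g hg =>
      rcases hg with ⟨v, rfl⟩ | ⟨v, rfl⟩
      · exact expEnd_ad_lie h3 _ (ad_vpos_cube v)
      · exact expEnd_ad_lie h3 _ (ad_vneg_cube v)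
    | one => intro X Y; rfl
    | mul a b _ _ ha hb => intro X Y; simp only [LinearEquiv.mul_apply, ha, hb]
    | inv a _ ha =>
      intro X Y
      apply a.injective
      rw [ha]
      simp only [← LinearEquiv.mul_apply, mul_inv_cancel]
      rfl
  exact this g.1 g.2 X Y

@[simp] theorem PE_mul_apply (g h : PE T) (X : TKK T) : (g * h).1 X = g.1 (h.1 X) := rfl
@[simp] theorem PE_inv_apply (g : PE T) (X : TKK T) : g⁻¹.1 (g.1 X) = X :=
  g.1.symm_apply_apply X
@[simp] theorem PE_apply_inv (g : PE T) (X : TKK T) : g.1 (g⁻¹.1 X) = X :=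
  g.1.apply_symm_apply X

theorem tau_apply (v : V) (X : TKK T) : (tau T v).1 X =
    X + ⁅vpos T v, X⁆ + ⅟(2 : K) • ⁅vpos T v, ⁅vpos T v, X⁆⁆ := rfl
theorem tauTilde_apply (v : V) (X : TKK T) : (tauTilde T v).1 X =
    X + ⁅vneg T v, X⁆ + ⅟(2 : K) • ⁅vneg T v, ⁅vneg T v, X⁆⁆ := rfl

theorem tau_inv (v : V) : (tau T v)⁻¹ = tau T (-v) := by
  apply Subtype.ext
  apply LinearEquiv.ext
  intro X
  change expEnd (-LieAlgebra.ad K (TKK T) (vpos T v)) X =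
    expEnd (LieAlgebra.ad K (TKK T) (vpos T (-v))) X
  rw [vpos_neg, map_neg]

theorem tauTilde_inv (v : V) : (tauTilde T v)⁻¹ = tauTilde T (-v) := by
  apply Subtype.ext
  apply LinearEquiv.ext
  intro X
  change expEnd (-LieAlgebra.ad K (TKK T) (vneg T v)) X =
    expEnd (LieAlgebra.ad K (TKK T) (vneg T (-v))) X
  rw [vneg_neg, map_neg]

/-- Induction over words in the generators of the projective elementary group. -/
theorem PE_induction {p : PE T → Prop} (one : p 1) (mul_tau : ∀ v g, p g → p (tau T v * g))
    (mul_tauTilde : ∀ v g, p g → p (tauTilde T v * g)) (g : PE T) : p g := by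
  obtain ⟨g, hg⟩ := g
  induction hg using Subgroup.closure_induction_left with
  | one => exact one
  | mul_left x hx y hy ih =>
    rcases hx with ⟨v, rfl⟩ | ⟨v, rfl⟩
    · exact mul_tau v ⟨y, hy⟩ ih
    · exact mul_tauTilde v ⟨y, hy⟩ ih
  | inv_mul_cancel x hx y hy ih =>
    rcases hx with ⟨v, rfl⟩ | ⟨v, rfl⟩
    · have := mul_tau (-v) ⟨y, hy⟩ ih
      rw [← tau_inv] at this
      exact this
    · have := mul_tauTilde (-v) ⟨y, hy⟩ ih
      rw [← tauTilde_inv] at this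
      exact this

/-! ### Stabilizers of the grading and of the base points -/

theorem mem_strGroup_iff (h3 : IsUnit (3 : K)) {g : PE T} :
    g ∈ strGroup T ↔ g.1 (euler T) = euler T := by
  constructor
  · intro hg
    apply eq_euler_of_lie_eq_deg
    intro X
    have := hg (g⁻¹.1 X)
    rwa [deg_eq_lie, PE_lie h3, PE_apply_inv] at this
  · intro hg X
    rw [deg_eq_lie, PE_lie h3, hg, deg_eq_lie]

theorem tau_euler (v : V) : (tau T v).1 (euler T) = euler T - vpos T v := by
  rw [tau_apply]
  apply ext <;> simp [comm_coe, inner_coe]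

theorem tauTilde_euler (v : V) : (tauTilde T v).1 (euler T) = euler T + vneg T v := by
  rw [tauTilde_apply]
  apply ext <;> simp [comm_coe, inner_coe]

@[simp] theorem tau_vpos (v w : V) : (tau T v).1 (vpos T w) = vpos T w := by
  rw [tau_apply]
  apply ext <;> simp [comm_coe, inner_coe]

@[simp] theorem tauTilde_vneg (v w : V) : (tauTilde T v).1 (vneg T w) = vneg T w := by
  rw [tauTilde_apply]
  apply ext <;> simp [comm_coe, inner_coe]

theorem strGroup_vneg {g : PE T} (hg : g ∈ strGroup T) (a : V) :
    ∃ b, g.1 (vneg T a) = vneg T b := by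
  have h : deg T (vneg T a) = -vneg T a := by rw [deg_apply]; apply ext <;> simp
  have := hg (vneg T a)
  rw [h, map_neg, deg_apply, neg_eq_iff_eq_neg] at this
  have hp : (g.1 (vneg T a)).pos = 0 := by
    have := congrArg pos this
    simp only [pos_neg, pos_mk] at this
    exact two_smul_eq_zero (K := K) (by rw [two_smul, add_eq_zero_iff_eq_neg]; exact this)
  refine ⟨(g.1 (vneg T a)).neg, ?_⟩
  rw [this]
  apply ext <;> simp [hp]

/-- The two properties are proved together: the first is stable under products only because the left
factor preserves V⁻. -/
theorem Pminus_apply (h3 : IsUnit (3 : K)) {g : PE T} (hg : g ∈ Pminus T) :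
    (∃ c, g.1 (euler T) = euler T + vneg T c) ∧ ∀ a, ∃ b, g.1 (vneg T a) = vneg T b := by
  let p : PE T → Prop := fun g =>
    (∃ c, g.1 (euler T) = euler T + vneg T c) ∧ ∀ a, ∃ b, g.1 (vneg T a) = vneg T b
  have p_mul : ∀ g h, p g → p h → p (g * h) := by
    rintro g h ⟨⟨c, hc⟩, hg⟩ ⟨⟨d, hd⟩, hh⟩
    refine ⟨?_, fun a => ?_⟩
    · obtain ⟨e, he⟩ := hg d
      exact ⟨c + e, by rw [PE_mul_apply, hd, map_add, hc, he, vneg_add, add_assoc]⟩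
    · obtain ⟨b, hb⟩ := hh a
      rw [PE_mul_apply, hb]
      exact hg b
  have p_tau : ∀ v, p (tauTilde T v) := fun v =>
    ⟨⟨v, tauTilde_euler v⟩, fun a => ⟨a, tauTilde_vneg v a⟩⟩
  have p_str : ∀ h ∈ strGroup T, p h := fun h hh =>
    ⟨⟨0, by rw [(mem_strGroup_iff h3).1 hh]; exact (add_zero _).symm⟩, strGroup_vneg hh⟩
  -- Preserving V⁻ does not pass formally to the inverse, so the subgroup demands the property of
  -- both g and g⁻¹.
  let S : Subgroup (PE T) :=
    { carrier := {g | p g ∧ p g⁻¹}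
      one_mem' := ⟨p_str _ (one_mem _), by rw [inv_one]; exact p_str _ (one_mem _)⟩
      mul_mem' := fun ha hb => ⟨p_mul _ _ ha.1 hb.1, by rw [mul_inv_rev]; exact p_mul _ _ hb.2 ha.2⟩
      inv_mem' := fun ha => ⟨ha.2, by rw [inv_inv]; exact ha.1⟩ }
  have hS : Pminus T ≤ S := by
    refine sup_le ((Subgroup.closure_le _).2 ?_) fun h hh => ⟨p_str h hh, p_str _ (inv_mem hh)⟩
    rintro _ ⟨v, rfl⟩
    exact ⟨p_tau v, by rw [tauTilde_inv]; exact p_tau _⟩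
  exact (hS hg).1

/-- Both g and exp(c) move `euler` in the same way, so their quotient fixes it. This yields the
normal form P⁻ = U⁻H. -/
theorem exists_tauTilde_mul (h3 : IsUnit (3 : K)) {g : PE T} {c : V}
    (hg : g.1 (euler T) = euler T + vneg T c) : ∃ h ∈ strGroup T, g = tauTilde T c * h := by
  refine ⟨(tauTilde T c)⁻¹ * g, (mem_strGroup_iff h3).2 ?_, by group⟩
  rw [PE_mul_apply, hg, ← tauTilde_euler, PE_inv_apply]

theorem mem_Pminus_of_euler (h3 : IsUnit (3 : K)) {g : PE T} {c : V}
    (hg : g.1 (euler T) = euler T + vneg T c) : g ∈ Pminus T := by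
  obtain ⟨h, hh, rfl⟩ := exists_tauTilde_mul h3 hg
  exact mul_mem (Subgroup.mem_sup_left (Subgroup.subset_closure ⟨c, rfl⟩))
    (Subgroup.mem_sup_right hh)

theorem exists_of_mem_Pminus (h3 : IsUnit (3 : K)) {g : PE T} (hg : g ∈ Pminus T) :
    ∃ c, ∃ h ∈ strGroup T, g = tauTilde T c * h := by
  obtain ⟨c, hc⟩ := (Pminus_apply h3 hg).1
  exact ⟨c, exists_tauTilde_mul h3 hc⟩

theorem tauTilde_mem_Pminus (v : V) : tauTilde T v ∈ Pminus T :=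
  Subgroup.mem_sup_left (Subgroup.subset_closure ⟨v, rfl⟩)

theorem tau_mem_Pplus (v : V) : tau T v ∈ Pplus T :=
  Subgroup.mem_sup_left (Subgroup.subset_closure ⟨v, rfl⟩)

/-- Transported from P⁻ by conjugation with the exchange automorphism, which is an involution of the
group. -/
theorem exists_of_mem_Pplus (h3 : IsUnit (3 : K)) {g : PE T} (hg : g ∈ Pplus T) :
    ∃ c, ∃ h ∈ strGroup T, g = tau T c * h := by
  let e := exchange T
  have hinv : ∀ g, e.conj (e.conj g) = g := fun g => by
    induction g using PE_induction with
    | one => simp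
    | mul_tau v g ih => rw [map_mul, map_mul, ih, e.conj_tau, e.conj_tauTilde]; rfl
    | mul_tauTilde v g ih => rw [map_mul, map_mul, ih, e.conj_tauTilde, e.conj_tau]; rfl
  have hle : Pplus T ≤ (Pminus T).comap e.conj := by
    refine sup_le ((Subgroup.closure_le _).2 ?_)
      (e.conj_strGroup.trans (Subgroup.comap_mono le_sup_right))
    rintro _ ⟨v, rfl⟩
    change e.conj _ ∈ Pminus T
    rw [e.conj_tau]
    exact tauTilde_mem_Pminus _
  obtain ⟨c, h, hh, hc⟩ := exists_of_mem_Pminus h3 (hle hg)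
  refine ⟨c, e.conj h, e.conj_strGroup hh, ?_⟩
  rw [← hinv g, hc, map_mul, e.conj_tauTilde]
  rfl

/-! ### Elements of the projective elementary group acting on points -/

theorem smul_op_eq_iff {g h : PE T} : g • op T = h • op T ↔ g⁻¹ * h ∈ Pminus T := by
  change ((g * 1 : PE T) : Xp T) = ((h * 1 : PE T) : Xp T) ↔ _
  rw [QuotientGroup.eq, mul_one, mul_one]

theorem smul_om_eq_iff {g h : PE T} : g • om T = h • om T ↔ g⁻¹ * h ∈ Pplus T := by
  change ((g * 1 : PE T) : Xm T) = ((h * 1 : PE T) : Xm T) ↔ _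
  rw [QuotientGroup.eq, mul_one, mul_one]

theorem exists_smul_op (x : Xp T) : ∃ g : PE T, x = g • op T := by
  induction x using QuotientGroup.induction_on with
  | H g => exact ⟨g, by change _ = ((g * 1 : PE T) : Xp T); rw [mul_one]⟩

theorem exists_smul_om (x : Xm T) : ∃ g : PE T, x = g • om T := by
  induction x using QuotientGroup.induction_on with
  | H g => exact ⟨g, by change _ = ((g * 1 : PE T) : Xm T); rw [mul_one]⟩

/-- The element exp(-v)exp(w) changes `euler` by v - w in V⁺, whereas elements of P⁻ change it only
in V⁻. -/
theorem chartP_injective (h3 : IsUnit (3 : K)) : Function.Injective (chartP T) := by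
  intro v w h
  have h := (Pminus_apply h3 (smul_op_eq_iff.1 h)).1
  obtain ⟨c, hc⟩ := h
  rw [PE_mul_apply, tau_euler, map_sub, tau_inv, tau_vpos, tau_euler] at hc
  have := congrArg pos hc
  simp only [pos_sub, pos_euler, pos_vpos, pos_add, pos_vneg] at this
  simpa [sub_eq_zero] using this

end Euler

/-! ## Homomorphisms of Jordan pairs and the maps they induce -/

section PairHom

variable {K : Type u} {V : Type v} [CommRing K] [AddCommGroup V] [Module K V]
variable {K' : Type u} {V' : Type v} [CommRing K'] [AddCommGroup V'] [Module K' V']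

/-- `(fp, fm)` is a homomorphism of the underlying Jordan pairs (additive, possibly over a
change of base rings). -/
structure IsPairHom (T : JTS K V) (T' : JTS K' V') (fp fm : V →+ V') : Prop where
  map_pos : ∀ x a y, fp (T.tri x a y) = T'.tri (fp x) (fm a) (fp y)
  map_neg : ∀ a x b, fm (T.tri a x b) = T'.tri (fm a) (fp x) (fm b)

/-- The elements `X` and `Y` of the two Lie algebras are related by the homomorphism
`(fp, fm)` of Jordan pairs. -/
structure Related {T : JTS K V} {T' : JTS K' V'} (fp fm : V →+ V') (X : TKK T) (Y : TKK T') :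
    Prop where
  pos : Y.pos = fp X.pos
  zer_fst : ∀ v, Y.zer.1.1 (fp v) = fp (X.zer.1.1 v)
  zer_snd : ∀ v, Y.zer.1.2 (fm v) = fm (X.zer.1.2 v)
  neg : Y.neg = fm X.neg

namespace Related

variable {T : JTS K V} {T' : JTS K' V'} {fp fm : V →+ V'} {X X₂ : TKK T} {Y Y₂ : TKK T'}

theorem add (h : Related fp fm X Y) (h₂ : Related fp fm X₂ Y₂) :
    Related fp fm (X + X₂) (Y + Y₂) where
  pos := by simp [h.pos, h₂.pos]
  zer_fst v := by simp [h.zer_fst, h₂.zer_fst]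
  zer_snd v := by simp [h.zer_snd, h₂.zer_snd]
  neg := by simp [h.neg, h₂.neg]

theorem sub (h : Related fp fm X Y) (h₂ : Related fp fm X₂ Y₂) :
    Related fp fm (X - X₂) (Y - Y₂) where
  pos := by simp [h.pos, h₂.pos]
  zer_fst v := by simp [h.zer_fst, h₂.zer_fst]
  zer_snd v := by simp [h.zer_snd, h₂.zer_snd]
  neg := by simp [h.neg, h₂.neg]

/-- The identities of a pair homomorphism say exactly that corresponding inner derivations are
related; commutators of related derivations are related automatically. -/
theorem lie (hf : IsPairHom T T' fp fm) (h : Related fp fm X Y) (h₂ : Related fp fm X₂ Y₂) :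
    Related fp fm ⁅X, X₂⁆ ⁅Y, Y₂⁆ where
  pos := by simp [h.pos, h₂.pos, h.zer_fst, h₂.zer_fst]
  zer_fst v := by
    simp [h.pos, h₂.pos, h.neg, h₂.neg, h.zer_fst, h₂.zer_fst, comm_coe, inner_coe, hf.map_pos]
  zer_snd v := by
    simp [h.pos, h₂.pos, h.neg, h₂.neg, h.zer_snd, h₂.zer_snd, comm_coe, inner_coe, hf.map_neg]
  neg := by simp [h.neg, h₂.neg, h.zer_snd, h₂.zer_snd]

theorem euler : Related fp fm (euler T) (JordanPolar.euler T') where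
  pos := by simp
  zer_fst v := by simp
  zer_snd v := by simp
  neg := by simp

theorem vpos (v : V) : Related fp fm (vpos T v) (TKK.vpos T' (fp v)) where
  pos := by simp
  zer_fst v := by simp
  zer_snd v := by simp
  neg := by simp

theorem vneg (v : V) : Related fp fm (vneg T v) (TKK.vneg T' (fm v)) where
  pos := by simp
  zer_fst v := by simp
  zer_snd v := by simp
  neg := by simp

/-- Pair homomorphisms are only additive, so that they may change the base ring; compatibility with
one half is the only scalar property the exponentials need. -/
theorem _root_.JordanPolar.map_half [Invertible (2 : K)] [Invertible (2 : K')] (f : V →+ V')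
    (v : V) : f (⅟(2 : K) • v) = ⅟(2 : K') • f v := by
  have h : (2 : K') • f (⅟(2 : K) • v) = f v := by
    rw [two_smul, ← map_add, ← add_smul, invOf_two_add_invOf_two, one_smul]
  rw [← h, smul_smul, invOf_mul_self, one_smul]

variable [Invertible (2 : K)] [Invertible (2 : K')]

theorem half (h : Related fp fm X Y) : Related fp fm (⅟(2 : K) • X) (⅟(2 : K') • Y) where
  pos := by simp [h.pos, map_half (K' := K')]
  zer_fst v := by simp [h.zer_fst, map_half (K' := K')]
  zer_snd v := by simp [h.zer_snd, map_half (K' := K')]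
  neg := by simp [h.neg, map_half (K' := K')]

theorem tau (hf : IsPairHom T T' fp fm) (h : Related fp fm X Y) (v : V) :
    Related fp fm ((tau T v).1 X) ((JordanPolar.tau T' (fp v)).1 Y) := by
  have h1 := (Related.vpos v).lie hf h
  exact (h.add h1).add ((Related.vpos v).lie hf h1).half

theorem tauTilde (hf : IsPairHom T T' fp fm) (h : Related fp fm X Y) (v : V) :
    Related fp fm ((tauTilde T v).1 X) ((JordanPolar.tauTilde T' (fm v)).1 Y) := by
  have h1 := (Related.vneg v).lie hf h
  exact (h.add h1).add ((Related.vneg v).lie hf h1).half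

end Related

/-! ### Related words and well-definedness -/

variable [Invertible (2 : K)] [Invertible (2 : K')]

/-- The relation between the projective elementary groups generated by the pairs
`(exp v, exp f(v))`. -/
def wordRel (T : JTS K V) (T' : JTS K' V') (fp fm : V → V') : Subgroup (PE T × PE T') :=
  Subgroup.closure (Set.range (fun v => (tau T v, tau T' (fp v))) ∪
    Set.range (fun v => (tauTilde T v, tauTilde T' (fm v))))

variable {T : JTS K V} {T' : JTS K' V'}

theorem tau_mem_wordRel (fp fm : V → V') (v : V) :
    (tau T v, tau T' (fp v)) ∈ wordRel T T' fp fm :=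
  Subgroup.subset_closure (Or.inl ⟨v, rfl⟩)

theorem tauTilde_mem_wordRel (fp fm : V → V') (v : V) :
    (tauTilde T v, tauTilde T' (fm v)) ∈ wordRel T T' fp fm :=
  Subgroup.subset_closure (Or.inr ⟨v, rfl⟩)

theorem tau_mul_mem_wordRel {fp fm : V → V'} (v : V) {g : PE T} {g' : PE T'}
    (h : (g, g') ∈ wordRel T T' fp fm) :
    (tau T v * g, tau T' (fp v) * g') ∈ wordRel T T' fp fm :=
  (wordRel T T' fp fm).mul_mem (tau_mem_wordRel fp fm v) h

theorem tauTilde_mul_mem_wordRel {fp fm : V → V'} (v : V) {g : PE T} {g' : PE T'}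
    (h : (g, g') ∈ wordRel T T' fp fm) :
    (tauTilde T v * g, tauTilde T' (fm v) * g') ∈ wordRel T T' fp fm :=
  (wordRel T T' fp fm).mul_mem (tauTilde_mem_wordRel fp fm v) h

/-- Only totality is available: g' depends on the word chosen for g, and is controlled only modulo
stabilizers. -/
theorem exists_wordRel (fp fm : V → V') (g : PE T) : ∃ g', (g, g') ∈ wordRel T T' fp fm := by
  induction g using PE_induction with
  | one => exact ⟨1, one_mem _⟩
  | mul_tau v g ih =>
    obtain ⟨g', h⟩ := ih
    exact ⟨_, tau_mul_mem_wordRel v h⟩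
  | mul_tauTilde v g ih =>
    obtain ⟨g', h⟩ := ih
    exact ⟨_, tauTilde_mul_mem_wordRel v h⟩

/-- Induction over words in the generators of `wordRel`. -/
theorem wordRel_induction {fp fm : V →+ V'} {p : PE T → PE T' → Prop} (one : p 1 1)
    (mul_tau : ∀ v g g', p g g' → p (tau T v * g) (tau T' (fp v) * g'))
    (mul_tauTilde : ∀ v g g', p g g' → p (tauTilde T v * g) (tauTilde T' (fm v) * g'))
    {g : PE T} {g' : PE T'} (hg : (g, g') ∈ wordRel T T' fp fm) : p g g' := by
  suffices ∀ x ∈ wordRel T T' fp fm, p x.1 x.2 from this _ hg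
  intro x hx
  induction hx using Subgroup.closure_induction_left with
  | one => exact one
  | mul_left x hx y hy ih =>
    rcases hx with ⟨v, rfl⟩ | ⟨v, rfl⟩
    · exact mul_tau v _ _ ih
    · exact mul_tauTilde v _ _ ih
  | inv_mul_cancel x hx y hy ih =>
    rcases hx with ⟨v, rfl⟩ | ⟨v, rfl⟩
    · have := mul_tau (-v) _ _ ih
      rwa [map_neg, ← tau_inv, ← tau_inv] at this
    · have := mul_tauTilde (-v) _ _ ih
      rwa [map_neg, ← tauTilde_inv, ← tauTilde_inv] at this

variable {fp fm : V →+ V'}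

theorem Related.smul (hf : IsPairHom T T' fp fm) {X : TKK T} {Y : TKK T'}
    (h : Related fp fm X Y) {g : PE T} {g' : PE T'} (hg : (g, g') ∈ wordRel T T' fp fm) :
    Related fp fm (g.1 X) (g'.1 Y) :=
  wordRel_induction (p := fun g g' => Related fp fm (g.1 X) (g'.1 Y)) h
    (fun v _ _ ih => ih.tau hf v) (fun v _ _ ih => ih.tauTilde hf v) hg

/-- The eigenvalues 1, 0, -1 of the grading give (ad E)³ = ad E, an identity that survives
conjugation. -/
theorem smul_euler_lie (h3 : IsUnit (3 : K)) (g : PE T) (X : TKK T) :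
    ⁅g.1 (euler T), ⁅g.1 (euler T), ⁅g.1 (euler T), X⁆⁆⁆ = ⁅g.1 (euler T), X⁆ := by
  have := congrArg g.1 (euler_lie_lie_lie (g⁻¹.1 X))
  simpa only [PE_lie h3, PE_apply_inv] using this

/-- The difference of the identities is 6N² = 0; what then remains is 2N = 0. -/
theorem apply_eq_zero_of_cube (h3 : IsUnit (3 : K)) {N : Module.End K V}
    (h : ∀ v, N (N (N v)) + 3 • N (N v) + 2 • N v = 0)
    (h' : ∀ v, N (N (N v)) - 3 • N (N v) + 2 • N v = 0) : N = 0 := by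
  have h2 : ∀ v, N (N v) = 0 := fun v => by
    apply two_smul_eq_zero (K := K)
    apply three_smul_eq_zero h3
    rw [← sub_self (0 : V)]
    nth_rw 1 [← h v]
    rw [← h' v]
    abel
  ext v
  apply two_smul_eq_zero (K := K)
  have := h v
  simp only [h2, map_zero, smul_zero, zero_add] at this
  rw [← this]
  abel

/-- An element of the structure group is related to elements of the structure group only. -/
theorem mem_strGroup_of_wordRel (h3 : IsUnit (3 : K)) (h3' : IsUnit (3 : K'))
    (hf : IsPairHom T T' fp fm) {g : PE T} {g' : PE T'} (hg : (g, g') ∈ wordRel T T' fp fm)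
    (h : g ∈ strGroup T) : g' ∈ strGroup T' := by
  obtain ⟨z, hz⟩ : ∃ z, z = g'.1 (euler T') - euler T' := ⟨_, rfl⟩
  have hgE : g'.1 (euler T') = euler T' + z := by rw [hz]; abel
  -- As g fixes `euler`, the error z is related to 0: it has degree zero and kills the images of
  -- `fp` and `fm`.
  have hr : Related fp fm (0 : TKK T) z := by
    have := (Related.euler (T := T) (T' := T') (fp := fp) (fm := fm)).smul hf hg
    rw [(mem_strGroup_iff h3).1 h] at this
    have := this.sub Related.euler
    rwa [sub_self, ← hz] at this
  have hp : z.pos = 0 := by simpa using hr.pos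
  have hn : z.neg = 0 := by simpa using hr.neg
  have h1 : ∀ v, z.zer.1.1 (fp v) = 0 := by simpa using hr.zer_fst
  have h2 : ∀ v, z.zer.1.2 (fm v) = 0 := by simpa using hr.zer_snd
  -- Each letter of g' comes from those images, so its bracket with z vanishes. Thus g'⁻¹ has error
  -- -z, which supplies the second cubic identity.
  have hfix : g'.1 z = z := by
    refine wordRel_induction (p := fun _ g' => g'.1 z = z) rfl (fun v _ _ ih => ?_)
      (fun v _ _ ih => ?_) hg
    · have : ⁅vpos T' (fp v), z⁆ = 0 := by apply ext <;> simp [comm_coe, inner_coe, h1, hn]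
      rw [PE_mul_apply, ih, tau_apply, this, lie_zero, smul_zero, add_zero, add_zero]
    · have : ⁅vneg T' (fm v), z⁆ = 0 := by apply ext <;> simp [comm_coe, inner_coe, h2, hp]
      rw [PE_mul_apply, ih, tauTilde_apply, this, lie_zero, smul_zero, add_zero, add_zero]
  have hgE' : g'⁻¹.1 (euler T') = euler T' - z := by
    have : euler T' = g'.1 (euler T' - z) := by rw [map_sub, hgE, hfix]; abel
    conv_lhs => rw [this]
    exact PE_inv_apply _ _
  have c := smul_euler_lie h3' g'
  have c' := smul_euler_lie h3' g'⁻¹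
  rw [hgE] at c
  rw [hgE'] at c'
  -- On V⁺ the conjugates of `euler` by g' and g'⁻¹ act as 1 + N and 1 - N; the equation F³ = F for
  -- both gives the two cubics. On V⁻ the roles are interchanged.
  have hN : z.zer.1.1 = 0 := by
    apply apply_eq_zero_of_cube h3' <;> intro v
    · have := congrArg pos (c (vpos T' v))
      simp [hp] at this
      rw [← sub_eq_zero] at this
      rw [← this]
      abel
    · have := congrArg pos (c' (vpos T' v))
      simp [hp] at this
      rw [← sub_eq_zero] at this
      rw [← neg_eq_zero, ← this]
      abel
  have hN' : z.zer.1.2 = 0 := by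
    apply apply_eq_zero_of_cube h3' <;> intro v
    · have := congrArg neg (c' (vneg T' v))
      simp [hn] at this
      rw [← sub_eq_zero] at this
      rw [← neg_eq_zero, ← this]
      abel
    · have := congrArg neg (c (vneg T' v))
      simp [hn] at this
      rw [← sub_eq_zero] at this
      rw [← this]
      abel
  have hz0 : z = 0 := by apply ext <;> simp [hp, hn, hN, hN']
  rw [mem_strGroup_iff h3', hgE, hz0, add_zero]

theorem mem_Pminus_of_wordRel (h3 : IsUnit (3 : K)) (h3' : IsUnit (3 : K'))
    (hf : IsPairHom T T' fp fm) {g : PE T} {g' : PE T'} (hg : (g, g') ∈ wordRel T T' fp fm)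
    (h : g ∈ Pminus T) : g' ∈ Pminus T' := by
  obtain ⟨c, k, hk, rfl⟩ := exists_of_mem_Pminus h3 h
  have := mul_mem (inv_mem (tauTilde_mem_wordRel fp fm c)) hg
  simp only [Prod.inv_mk, Prod.mk_mul_mk, inv_mul_cancel_left] at this
  have hk' := mem_strGroup_of_wordRel h3 h3' hf this hk
  rw [← mul_inv_cancel_left (tauTilde T' (fm c)) g']
  exact mul_mem (tauTilde_mem_Pminus _) (Subgroup.mem_sup_right hk')

theorem mem_Pplus_of_wordRel (h3 : IsUnit (3 : K)) (h3' : IsUnit (3 : K'))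
    (hf : IsPairHom T T' fp fm) {g : PE T} {g' : PE T'} (hg : (g, g') ∈ wordRel T T' fp fm)
    (h : g ∈ Pplus T) : g' ∈ Pplus T' := by
  obtain ⟨c, k, hk, rfl⟩ := exists_of_mem_Pplus h3 h
  have := mul_mem (inv_mem (tau_mem_wordRel fp fm c)) hg
  simp only [Prod.inv_mk, Prod.mk_mul_mk, inv_mul_cancel_left] at this
  have hk' := mem_strGroup_of_wordRel h3 h3' hf this hk
  rw [← mul_inv_cancel_left (tau T' (fp c)) g']
  exact mul_mem (tau_mem_Pplus _) (Subgroup.mem_sup_right hk')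

/-! ### Existence and uniqueness of induced maps -/

theorem exists_inducedBy (h3 : IsUnit (3 : K)) (h3' : IsUnit (3 : K'))
    (hf : IsPairHom T T' fp fm) : ∃ Φp Φm, InducedBy T T' fp fm Φp Φm := by
  -- The value is characterized by all related words at once, so that equivariance follows after the
  -- choice.
  have hp : ∀ x : Xp T, ∃ y : Xp T', ∀ g g', (g, g') ∈ wordRel T T' fp fm → x = g • op T →
      y = g' • op T' := by
    intro x
    obtain ⟨g, rfl⟩ := exists_smul_op x
    obtain ⟨g', hg⟩ := exists_wordRel (T' := T') fp fm g
    refine ⟨g' • op T', fun k k' hk h => smul_op_eq_iff.2 ?_⟩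
    exact mem_Pminus_of_wordRel h3 h3' hf (mul_mem (inv_mem hg) hk) (smul_op_eq_iff.1 h)
  have hm : ∀ x : Xm T, ∃ y : Xm T', ∀ g g', (g, g') ∈ wordRel T T' fp fm → x = g • om T →
      y = g' • om T' := by
    intro x
    obtain ⟨g, rfl⟩ := exists_smul_om x
    obtain ⟨g', hg⟩ := exists_wordRel (T' := T') fp fm g
    refine ⟨g' • om T', fun k k' hk h => smul_om_eq_iff.2 ?_⟩
    exact mem_Pplus_of_wordRel h3 h3' hf (mul_mem (inv_mem hg) hk) (smul_om_eq_iff.1 h)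
  choose Φp hΦp using hp
  choose Φm hΦm using hm
  refine ⟨Φp, Φm, ?_, ?_, fun v x => ?_, fun v x => ?_, fun v x => ?_, fun v x => ?_⟩
  · simpa using hΦp _ 1 1 (one_mem _) (one_smul _ _).symm
  · simpa using hΦm _ 1 1 (one_mem _) (one_smul _ _).symm
  · obtain ⟨g, rfl⟩ := exists_smul_op x
    obtain ⟨g', hg⟩ := exists_wordRel (T' := T') fp fm g
    rw [hΦp _ _ _ hg rfl, hΦp _ _ _ (tau_mul_mem_wordRel v hg) (mul_smul _ _ _).symm,
      mul_smul]
  · obtain ⟨g, rfl⟩ := exists_smul_op x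
    obtain ⟨g', hg⟩ := exists_wordRel (T' := T') fp fm g
    rw [hΦp _ _ _ hg rfl,
      hΦp _ _ _ (tauTilde_mul_mem_wordRel v hg) (mul_smul _ _ _).symm, mul_smul]
  · obtain ⟨g, rfl⟩ := exists_smul_om x
    obtain ⟨g', hg⟩ := exists_wordRel (T' := T') fp fm g
    rw [hΦm _ _ _ hg rfl, hΦm _ _ _ (tau_mul_mem_wordRel v hg) (mul_smul _ _ _).symm,
      mul_smul]
  · obtain ⟨g, rfl⟩ := exists_smul_om x
    obtain ⟨g', hg⟩ := exists_wordRel (T' := T') fp fm g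
    rw [hΦm _ _ _ hg rfl,
      hΦm _ _ _ (tauTilde_mul_mem_wordRel v hg) (mul_smul _ _ _).symm, mul_smul]

namespace InducedBy

theorem smul_p {fp fm : V → V'} {Φp : Xp T → Xp T'} {Φm : Xm T → Xm T'}
    (h : InducedBy T T' fp fm Φp Φm) {g : PE T} {g' : PE T'} (hg : (g, g') ∈ wordRel T T' fp fm) :
    ∀ x, Φp (g • x) = g' • Φp x := by
  suffices ∀ k ∈ wordRel T T' fp fm, ∀ x, Φp (k.1 • x) = k.2 • Φp x from this _ hg
  intro k hk
  induction hk using Subgroup.closure_induction with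
  | mem k hk =>
    rcases hk with ⟨v, rfl⟩ | ⟨v, rfl⟩
    · exact h.tau_p v
    · exact h.tauTilde_p v
  | one => intro x; simp
  | mul a b _ _ ha hb =>
    intro x
    rw [Prod.fst_mul, Prod.snd_mul, mul_smul, mul_smul, ha, hb]
  | inv a _ ha =>
    intro x
    rw [Prod.fst_inv, Prod.snd_inv, eq_inv_smul_iff, ← ha, smul_inv_smul]

theorem smul_m {fp fm : V → V'} {Φp : Xp T → Xp T'} {Φm : Xm T → Xm T'}
    (h : InducedBy T T' fp fm Φp Φm) {g : PE T} {g' : PE T'} (hg : (g, g') ∈ wordRel T T' fp fm) :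
    ∀ x, Φm (g • x) = g' • Φm x := by
  suffices ∀ k ∈ wordRel T T' fp fm, ∀ x, Φm (k.1 • x) = k.2 • Φm x from this _ hg
  intro k hk
  induction hk using Subgroup.closure_induction with
  | mem k hk =>
    rcases hk with ⟨v, rfl⟩ | ⟨v, rfl⟩
    · exact h.tau_m v
    · exact h.tauTilde_m v
  | one => intro x; simp
  | mul a b _ _ ha hb =>
    intro x
    rw [Prod.fst_mul, Prod.snd_mul, mul_smul, mul_smul, ha, hb]
  | inv a _ ha =>
    intro x
    rw [Prod.fst_inv, Prod.snd_inv, eq_inv_smul_iff, ← ha, smul_inv_smul]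

theorem unique {fp fm : V → V'} {Φp Ψp : Xp T → Xp T'} {Φm Ψm : Xm T → Xm T'}
    (h : InducedBy T T' fp fm Φp Φm) (h' : InducedBy T T' fp fm Ψp Ψm) : Φp = Ψp ∧ Φm = Ψm := by
  constructor <;> ext x
  · obtain ⟨g, rfl⟩ := exists_smul_op x
    obtain ⟨g', hg⟩ := exists_wordRel (T' := T') fp fm g
    rw [h.smul_p hg, h'.smul_p hg, h.base_p, h'.base_p]
  · obtain ⟨g, rfl⟩ := exists_smul_om x
    obtain ⟨g', hg⟩ := exists_wordRel (T' := T') fp fm g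
    rw [h.smul_m hg, h'.smul_m hg, h.base_m, h'.base_m]

theorem comp {K'' : Type u} {V'' : Type v} [CommRing K''] [AddCommGroup V''] [Module K'' V'']
    [Invertible (2 : K'')] {T'' : JTS K'' V''} {fp fm : V → V'} {kp km : V' → V''}
    {Φp : Xp T → Xp T'} {Φm : Xm T → Xm T'} {Ψp : Xp T' → Xp T''} {Ψm : Xm T' → Xm T''}
    (h' : InducedBy T' T'' kp km Ψp Ψm) (h : InducedBy T T' fp fm Φp Φm) :
    InducedBy T T'' (kp ∘ fp) (km ∘ fm) (Ψp ∘ Φp) (Ψm ∘ Φm) where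
  base_p := by simp [h.base_p, h'.base_p]
  base_m := by simp [h.base_m, h'.base_m]
  tau_p v x := by simp [h.tau_p, h'.tau_p]
  tauTilde_p v x := by simp [h.tauTilde_p, h'.tauTilde_p]
  tau_m v x := by simp [h.tau_m, h'.tau_m]
  tauTilde_m v x := by simp [h.tauTilde_m, h'.tauTilde_m]

theorem refl (T : JTS K V) : InducedBy T T id id id id where
  base_p := rfl
  base_m := rfl
  tau_p _ _ := rfl
  tauTilde_p _ _ := rfl
  tau_m _ _ := rfl
  tauTilde_m _ _ := rfl

theorem chartP {fp fm : V → V'} {Φp : Xp T → Xp T'} {Φm : Xm T → Xm T'}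
    (h : InducedBy T T' fp fm Φp Φm) (v : V) :
    Φp (chartP T v) = JordanPolar.chartP T' (fp v) := by
  rw [JordanPolar.chartP, h.tau_p, h.base_p, JordanPolar.chartP]

theorem chartM {fp fm : V → V'} {Φp : Xp T → Xp T'} {Φm : Xm T → Xm T'}
    (h : InducedBy T T' fp fm Φp Φm) (v : V) :
    Φm (chartM T v) = JordanPolar.chartM T' (fm v) := by
  rw [JordanPolar.chartM, h.tauTilde_m, h.base_m, JordanPolar.chartM]

end InducedBy

end PairHom

/-! ## Induced maps are homomorphisms of geometries -/

section IsHom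

variable {K : Type u} {V : Type v} [CommRing K] [AddCommGroup V] [Module K V]
  [Invertible (2 : K)] {T T' : JTS K V}

theorem Graded.mapP_smul (c : Graded T) (g : PE T) (x : Xp T) :
    c.mapP (g • x) = c.conj g • c.mapP x := by
  induction x using QuotientGroup.induction_on with
  | H h =>
    change ((c.conj (g * h) : PE T) : Xp T) = ((c.conj g * c.conj h : PE T) : Xp T)
    rw [map_mul]

theorem Graded.mapM_smul (c : Graded T) (g : PE T) (x : Xm T) :
    c.mapM (g • x) = c.conj g • c.mapM x := by
  induction x using QuotientGroup.induction_on with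
  | H h =>
    change ((c.conj (g * h) : PE T) : Xm T) = ((c.conj g * c.conj h : PE T) : Xm T)
    rw [map_mul]

theorem Graded.mapP_op (c : Graded T) : c.mapP (op T) = op T := by
  change ((c.conj 1 : PE T) : Xp T) = ((1 : PE T) : Xp T)
  rw [map_one]

theorem Graded.mapM_om (c : Graded T) : c.mapM (om T) = om T := by
  change ((c.conj 1 : PE T) : Xm T) = ((1 : PE T) : Xm T)
  rw [map_one]

theorem Graded.inducedBy (c : Graded T) : InducedBy T T c.f c.g c.mapP c.mapM where
  base_p := c.mapP_op
  base_m := c.mapM_om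
  tau_p v x := by rw [c.mapP_smul, c.conj_tau]
  tauTilde_p v x := by rw [c.mapP_smul, c.conj_tauTilde]
  tau_m v x := by rw [c.mapM_smul, c.conj_tau]
  tauTilde_m v x := by rw [c.mapM_smul, c.conj_tauTilde]

variable {fp fm : V →ₗ[K] V} {Φp : Xp T → Xp T'} {Φm : Xm T → Xm T'}

/-- Both composites are induced by the same pair of maps because `fp` and `fm` are linear;
uniqueness identifies them. -/
theorem InducedBy.scaling (h : InducedBy T T' fp fm Φp Φm) (r : Kˣ) :
    Φp ∘ (scaling T r).mapP = (scaling T' r).mapP ∘ Φp ∧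
      Φm ∘ (JordanPolar.scaling T r).mapM = (JordanPolar.scaling T' r).mapM ∘ Φm := by
  have h1 := h.comp (JordanPolar.scaling T r).inducedBy
  have h2 := (JordanPolar.scaling T' r).inducedBy.comp h
  have hp : fp ∘ (JordanPolar.scaling T r).f = (JordanPolar.scaling T' r).f ∘ fp :=
    funext fun v => map_smul fp _ v
  have hm : fm ∘ (JordanPolar.scaling T r).g = (JordanPolar.scaling T' r).g ∘ fm :=
    funext fun v => map_smul fm _ v
  rw [hp, hm] at h1
  exact h1.unique h2

/-- Every structure relation is the translate of a standard one by some g; it suffices to translate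
its image by a related g'. -/
theorem InducedBy.isHom (h : InducedBy T T' fp fm Φp Φm) : IsHom T T' Φp Φm where
  transv := by
    rintro _ _ ⟨g, rfl, rfl⟩
    obtain ⟨g', hg⟩ := exists_wordRel (T' := T') fp fm g
    exact ⟨g', by rw [h.smul_p hg, h.base_p], by rw [h.smul_m hg, h.base_m]⟩
  piP := by
    rintro r _ _ _ _ ⟨g, u, rfl, rfl, rfl, rfl⟩
    obtain ⟨g', hg⟩ := exists_wordRel (T' := T') fp fm g
    exact ⟨g', fp u, by rw [h.smul_p hg, h.base_p], by rw [h.smul_m hg, h.base_m],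
      by rw [h.smul_p hg, h.chartP], by rw [h.smul_p hg, h.chartP, map_smul]⟩
  piM := by
    rintro r _ _ _ _ ⟨g, u, rfl, rfl, rfl, rfl⟩
    obtain ⟨g', hg⟩ := exists_wordRel (T' := T') fp fm g
    exact ⟨g', fm u, by rw [h.smul_p hg, h.base_p], by rw [h.smul_m hg, h.base_m],
      by rw [h.smul_m hg, h.chartM], by rw [h.smul_m hg, h.chartM, map_smul]⟩
  sigmaP := by
    rintro _ _ _ _ _ ⟨g, u, v, rfl, rfl, rfl, rfl, rfl⟩
    obtain ⟨g', hg⟩ := exists_wordRel (T' := T') fp fm g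
    exact ⟨g', fp u, fp v, by rw [h.smul_p hg, h.base_p], by rw [h.smul_m hg, h.base_m],
      by rw [h.smul_p hg, h.chartP], by rw [h.smul_p hg, h.chartP],
      by rw [h.smul_p hg, h.chartP, map_add]⟩
  sigmaM := by
    rintro _ _ _ _ _ ⟨g, u, v, rfl, rfl, rfl, rfl, rfl⟩
    obtain ⟨g', hg⟩ := exists_wordRel (T' := T') fp fm g
    exact ⟨g', fm u, fm v, by rw [h.smul_p hg, h.base_p], by rw [h.smul_m hg, h.base_m],
      by rw [h.smul_m hg, h.chartM], by rw [h.smul_m hg, h.chartM],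
      by rw [h.smul_m hg, h.chartM, map_add]⟩
  dilP := by
    rintro r _ _ y _ ⟨g, rfl, rfl, rfl⟩
    obtain ⟨g', hg⟩ := exists_wordRel (T' := T') fp fm g
    refine ⟨g', by rw [h.smul_p hg, h.base_p], by rw [h.smul_m hg, h.base_m], ?_⟩
    have := congrFun (h.scaling r).1 (g⁻¹ • y)
    simp only [Function.comp_apply] at this
    rw [h.smul_p hg, this, h.smul_p (g := g⁻¹) (g' := g'⁻¹) ((wordRel _ _ _ _).inv_mem hg)]
  dilM := by
    rintro r _ _ y _ ⟨g, rfl, rfl, rfl⟩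
    obtain ⟨g', hg⟩ := exists_wordRel (T' := T') fp fm g
    refine ⟨g', by rw [h.smul_p hg, h.base_p], by rw [h.smul_m hg, h.base_m], ?_⟩
    have := congrFun (h.scaling r⁻¹).2 (g⁻¹ • y)
    simp only [Function.comp_apply] at this
    rw [h.smul_m hg, this, h.smul_m (g := g⁻¹) (g' := g'⁻¹) ((wordRel _ _ _ _).inv_mem hg)]

end IsHom

/-! ## The stabilizer `P⁻` in terms of quadratic vector fields on `V⁺` -/

section Annihilator

variable {K : Type u} {V : Type v} [CommRing K] [AddCommGroup V] [Module K V]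

/-- The elements of `V⁻` that act trivially on `V⁺`. -/
def annNeg (T : JTS K V) : Submodule K V where
  carrier := {n | ∀ x y, T.tri x n y = 0}
  zero_mem' x y := by simp
  add_mem' ha hb x y := by simp [ha x y, hb x y]
  smul_mem' r a ha x y := by simp [ha x y]

variable {T : JTS K V}

/-- With n in the second slot of the operator, every term of the Jordan identity vanishes except the
middle one. -/
theorem tri_mem_annNeg {n : V} (hn : n ∈ annNeg T) (x a : V) : T.tri n x a ∈ annNeg T := by
  intro p q
  have h : ∀ x y, T.tri x n y = 0 := hn
  have := T.jordan x n p a q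
  simp only [h, map_zero, LinearMap.zero_apply, zero_sub, add_zero] at this
  exact neg_eq_zero.1 this.symm

/-- The ideal of the Lie algebra generated by `annNeg T ⊆ V⁻`. -/
def annIdeal (T : JTS K V) : Submodule K (TKK T) :=
  Submodule.span K ({X | ∃ n ∈ annNeg T, X = vneg T n} ∪
    {X | ∃ x, ∃ n ∈ annNeg T, X = ⁅vpos T x, vneg T n⁆})

theorem vneg_mem_annIdeal {n : V} (hn : n ∈ annNeg T) : vneg T n ∈ annIdeal T :=
  Submodule.subset_span (Or.inl ⟨n, hn, rfl⟩)

theorem lie_vneg_mem_annIdeal (x : V) {n : V} (hn : n ∈ annNeg T) :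
    ⁅vpos T x, vneg T n⁆ ∈ annIdeal T :=
  Submodule.subset_span (Or.inr ⟨x, n, hn, rfl⟩)

theorem annIdeal_induction {p : ∀ X, X ∈ annIdeal T → Prop} (zero : p 0 (zero_mem _))
    (add : ∀ X Y hX hY, p X hX → p Y hY → p (X + Y) (add_mem hX hY))
    (smul : ∀ (r : K) X hX, p X hX → p (r • X) (Submodule.smul_mem _ r hX))
    (neg : ∀ n (hn : n ∈ annNeg T), p (vneg T n) (vneg_mem_annIdeal hn))
    (lie : ∀ x, ∀ n (hn : n ∈ annNeg T), p ⁅vpos T x, vneg T n⁆ (lie_vneg_mem_annIdeal x hn))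
    {X : TKK T} (hX : X ∈ annIdeal T) : p X hX := by
  induction hX using Submodule.span_induction with
  | mem X hX =>
    rcases hX with ⟨n, hn, rfl⟩ | ⟨x, n, hn, rfl⟩
    · exact neg n hn
    · exact lie x n hn
  | zero => exact zero
  | add X Y _ _ hX hY => exact add X Y _ _ hX hY
  | smul r X _ hX => exact smul r X _ hX

/-- This is why two kinds of generators suffice: bracketing with V⁺ never climbs to degree one. -/
theorem lie_vpos_vneg_lie_vpos (y x : V) {n : V} (hn : n ∈ annNeg T) :
    ⁅vpos T y, ⁅vpos T x, vneg T n⁆⁆ = 0 := by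
  have h : ∀ x y, T.tri x n y = 0 := hn
  apply ext <;> simp [comm_coe, inner_coe, h]

theorem lie_vneg_lie_vpos_vneg (a x n : V) :
    ⁅vneg T a, ⁅vpos T x, vneg T n⁆⁆ = vneg T (-T.tri n x a) := by
  apply ext <;> simp [comm_coe, inner_coe]

theorem lie_vneg_vneg (a n : V) : ⁅vneg T a, vneg T n⁆ = 0 := by
  apply ext <;> simp [comm_coe, inner_coe]

theorem lie_vpos_mem_annIdeal (y : V) {X : TKK T} (hX : X ∈ annIdeal T) :
    ⁅vpos T y, X⁆ ∈ annIdeal T := by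
  induction hX using annIdeal_induction with
  | zero => simp
  | add X Y _ _ hX hY => rw [lie_add]; exact add_mem hX hY
  | smul r X _ hX => rw [lie_smul]; exact Submodule.smul_mem _ _ hX
  | neg n hn => exact lie_vneg_mem_annIdeal y hn
  | lie x n hn => rw [lie_vpos_vneg_lie_vpos _ _ hn]; exact zero_mem _

theorem lie_vneg_mem_annIdeal' (a : V) {X : TKK T} (hX : X ∈ annIdeal T) :
    ⁅vneg T a, X⁆ ∈ annIdeal T := by
  induction hX using annIdeal_induction with
  | zero => simp
  | add X Y _ _ hX hY => rw [lie_add]; exact add_mem hX hY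
  | smul r X _ hX => rw [lie_smul]; exact Submodule.smul_mem _ _ hX
  | neg n hn => rw [lie_vneg_vneg]; exact zero_mem _
  | lie x n hn =>
    rw [lie_vneg_lie_vpos_vneg]
    exact vneg_mem_annIdeal (neg_mem (tri_mem_annNeg hn x a))

/-- Only the eigenvalues -1 and 0 of the grading occur on this subspace. -/
theorem euler_lie_lie_of_mem_annIdeal {X : TKK T} (hX : X ∈ annIdeal T) :
    ⁅euler T, ⁅euler T, X⁆⁆ = -⁅euler T, X⁆ := by
  have : X.pos = 0 := by
    induction hX using annIdeal_induction with
    | zero => rfl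
    | add X Y _ _ hX hY => simp [hX, hY]
    | smul r X _ hX => simp [hX]
    | neg n hn => rfl
    | lie x n hn => simp
  simp only [← deg_eq_lie, deg_apply]
  apply ext <;> simp [this]

variable [Invertible (2 : K)]

theorem PE_apply_mem_annIdeal (g : PE T) {X : TKK T} (hX : X ∈ annIdeal T) :
    g.1 X ∈ annIdeal T := by
  induction g using PE_induction with
  | one => exact hX
  | mul_tau v g ih =>
    have := lie_vpos_mem_annIdeal v ih
    exact add_mem (add_mem ih this) (Submodule.smul_mem _ _ (lie_vpos_mem_annIdeal v this))
  | mul_tauTilde v g ih =>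
    have := lie_vneg_mem_annIdeal' v ih
    exact add_mem (add_mem ih this) (Submodule.smul_mem _ _ (lie_vneg_mem_annIdeal' v this))

/-- On V⁻ the element gE acts as -1 + N modulo other degrees, and the quadratic identity (-1 + N)² =
1 - N reads N² = N. -/
theorem lie_lie_eq_of_mem_annNeg (h3 : IsUnit (3 : K)) (g : PE T) {z : TKK T}
    (hz : g.1 (euler T) = euler T + z) (hp : z.pos = 0)
    {n : V} (hn : n ∈ annNeg T) :
    ⁅z, vneg T n⁆ = vneg T (z.zer.1.2 n) ∧ z.zer.1.2 (z.zer.1.2 n) = z.zer.1.2 n := by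
  refine ⟨by apply ext <;> simp [comm_coe, inner_coe, hp], ?_⟩
  -- The quadratic identity is used at g⁻¹n, which stays in the invariant subspace, and is then
  -- carried back by g.
  have h := congrArg g.1
    (euler_lie_lie_of_mem_annIdeal (PE_apply_mem_annIdeal g⁻¹ (vneg_mem_annIdeal hn)))
  simp only [map_neg, PE_lie h3, PE_apply_inv, hz] at h
  have := congrArg neg h
  simp [hp, comm_coe, inner_coe] at this
  rw [← sub_eq_zero] at this ⊢
  rw [← this]
  abel

/-- Modulo `annNeg`, z acts on a generator [x,n] by replacing n with Nn, hence idempotently; the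
corrections involving the V⁻ component of z lie in `annNeg`. -/
theorem lie_lie_sub_lie_of_mem_annIdeal (h3 : IsUnit (3 : K)) (g : PE T) {z : TKK T}
    (hz : g.1 (euler T) = euler T + z) (hp : z.pos = 0) (hf : z.zer.1.1 = 0)
    {X : TKK T} (hX : X ∈ annIdeal T) : ∃ n ∈ annNeg T, ⁅z, ⁅z, X⁆⁆ - ⁅z, X⁆ = vneg T n := by
  have hN : ∀ v, z.zer.1.2 v ∈ annNeg T := fun v x y => by
    simpa [hf] using (z.zer.2.1 x v y).symm
  have key := fun n hn => lie_lie_eq_of_mem_annNeg h3 g hz hp (n := n) hn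
  induction hX using annIdeal_induction with
  | zero => exact ⟨0, zero_mem _, by simp; apply ext <;> simp⟩
  | add X Y _ _ hX hY =>
    obtain ⟨n, hn, h⟩ := hX
    obtain ⟨m, hm, h'⟩ := hY
    exact ⟨n + m, add_mem hn hm, by simp only [lie_add]; rw [vneg_add, ← h, ← h']; abel⟩
  | smul r X _ hX =>
    obtain ⟨n, hn, h⟩ := hX
    refine ⟨r • n, Submodule.smul_mem _ _ hn, ?_⟩
    simp only [lie_smul, ← smul_sub, h]
    apply ext <;> simp
  | neg n hn =>
    refine ⟨0, zero_mem _, ?_⟩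
    rw [(key n hn).1, (key _ (hN n)).1, (key n hn).2, sub_self]
    apply ext <;> simp
  | lie x n hn =>
    have h1 : ∀ m ∈ annNeg T, ⁅z, ⁅vpos T x, vneg T m⁆⁆ =
        ⁅vpos T x, vneg T (z.zer.1.2 m)⁆ + vneg T (-T.tri m x z.neg) := by
      intro m hm
      have h' := fun v => z.zer.2.2 m x v
      apply ext
      · simp [hp, hf, comm_coe, inner_coe]
      · ext v
        simp [hp, hf, comm_coe, inner_coe, hN m x v]
      · ext v
        simp [hp, hf, comm_coe, inner_coe, h']
      · simp [comm_coe, inner_coe]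
    refine ⟨-T.tri (z.zer.1.2 n) x z.neg + z.zer.1.2 (-T.tri n x z.neg) - -T.tri n x z.neg, ?_, ?_⟩
    · exact sub_mem (add_mem (neg_mem (tri_mem_annNeg (hN n) _ _)) (hN _))
        (neg_mem (tri_mem_annNeg hn _ _))
    · rw [h1 n hn, lie_add, h1 _ (hN n), (key _ (neg_mem (tri_mem_annNeg hn _ _))).1,
        (key n hn).2, sub_eq_add_neg (_ + _) (-T.tri n x z.neg), vneg_add, vneg_add,
        vneg_neg (-T.tri n x z.neg)]
      abel

/-- An element of `PE` such that it and its inverse fix the Euler vector field on `V⁺` up to a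
vector field of degree `-1` belongs to `P⁻`. -/
theorem mem_Pminus_of_pos_zer (h3 : IsUnit (3 : K)) {g : PE T}
    (hp : (g.1 (euler T)).pos = 0) (hf : (g.1 (euler T)).zer.1.1 = 1)
    (hp' : (g⁻¹.1 (euler T)).pos = 0) (hf' : (g⁻¹.1 (euler T)).zer.1.1 = 1) : g ∈ Pminus T := by
  obtain ⟨z, hz⟩ : ∃ z, z = g.1 (euler T) - euler T := ⟨_, rfl⟩
  obtain ⟨w, hw⟩ : ∃ w, w = g⁻¹.1 (euler T) - euler T := ⟨_, rfl⟩
  have hzE : g.1 (euler T) = euler T + z := by rw [hz]; abel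
  have hwE : g⁻¹.1 (euler T) = euler T + w := by rw [hw]; abel
  -- Conjugation by g turns identities for the error of g⁻¹ into identities for -z.
  have hgw : g.1 w = -z := by rw [hw, hz, map_sub, PE_apply_inv]; abel
  have hzp : z.pos = 0 := by simp [hz, hp]
  have hwp : w.pos = 0 := by rw [hw, pos_sub, hp', pos_euler, sub_zero]
  have hzf : z.zer.1.1 = 0 := by simp [hz, hf]
  have hwf : w.zer.1.1 = 0 := by
    rw [hw, ← sub_self (1 : Module.End K V)]
    nth_rw 1 [← hf']
    rfl
  -- The derivation z acts as zero on V⁺, so its identity on T(x,v,y) leaves only T(x,Nv,y) = 0.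
  have hN : ∀ v, z.zer.1.2 v ∈ annNeg T := fun v x y => by
    simpa [hzf] using (z.zer.2.1 x v y).symm
  -- `(ad z)² (ad z - 1)²` and `(ad z)² (ad z + 1)²` vanish on the ideal
  have e1 : ∀ X ∈ annIdeal T,
      ⁅z, ⁅z, ⁅z, ⁅z, X⁆⁆⁆⁆ - 2 • ⁅z, ⁅z, ⁅z, X⁆⁆⁆ + ⁅z, ⁅z, X⁆⁆ = 0 := by
    intro X hX
    obtain ⟨n, hn, h⟩ := lie_lie_sub_lie_of_mem_annIdeal h3 g hzE hzp hzf hX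
    have k := lie_lie_eq_of_mem_annNeg h3 g hzE hzp hn
    have k' := lie_lie_eq_of_mem_annNeg h3 g hzE hzp (hN n)
    have : ⁅z, ⁅z, vneg T n⁆⁆ - ⁅z, vneg T n⁆ = 0 := by
      rw [k.1, k'.1, k.2, sub_self]
    rw [← h] at this
    simp only [lie_sub] at this
    rw [← this]
    abel
  have e2 : ∀ X ∈ annIdeal T,
      ⁅z, ⁅z, ⁅z, ⁅z, X⁆⁆⁆⁆ + 2 • ⁅z, ⁅z, ⁅z, X⁆⁆⁆ + ⁅z, ⁅z, X⁆⁆ = 0 := by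
    intro X hX
    obtain ⟨n, hn, h⟩ := lie_lie_sub_lie_of_mem_annIdeal h3 g⁻¹ hwE hwp hwf
      (PE_apply_mem_annIdeal g⁻¹ hX)
    have hM : w.zer.1.2 n ∈ annNeg T := fun x y => by
      simpa [hwf] using (w.zer.2.1 x n y).symm
    have k := lie_lie_eq_of_mem_annNeg h3 g⁻¹ hwE hwp hn
    have k' := lie_lie_eq_of_mem_annNeg h3 g⁻¹ hwE hwp hM
    have : ⁅w, ⁅w, vneg T n⁆⁆ - ⁅w, vneg T n⁆ = 0 := by
      rw [k.1, k'.1, k.2, sub_self]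
    rw [← h] at this
    have := congrArg g.1 this
    simp only [lie_sub, map_sub, PE_lie h3, hgw, PE_apply_inv, _root_.neg_lie, lie_neg, map_zero] at this
    rw [← this]
    abel
  -- The two quartic identities differ by 4(ad z)³.
  have e3 : ∀ X ∈ annIdeal T, ⁅z, ⁅z, ⁅z, X⁆⁆⁆ = 0 := by
    intro X hX
    apply two_smul_eq_zero (K := K)
    apply two_smul_eq_zero (K := K)
    rw [← sub_self (0 : TKK T)]
    nth_rw 1 [← e2 X hX]
    rw [← e1 X hX]
    abel
  -- On `annNeg`, ad z is the idempotent N and is also nilpotent, hence zero.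
  have hNK : ∀ n ∈ annNeg T, z.zer.1.2 n = 0 := by
    intro n hn
    have k := lie_lie_eq_of_mem_annNeg h3 g hzE hzp hn
    have k' := lie_lie_eq_of_mem_annNeg h3 g hzE hzp (hN n)
    have := e1 _ (vneg_mem_annIdeal hn)
    rw [e3 _ (vneg_mem_annIdeal hn), lie_zero, k.1, k'.1, k.2] at this
    simpa using congrArg neg this
  -- Since N maps into `annNeg`, now N² = 0, and (-1 + N)³ = -1 + N reduces to 2N = 0.
  have hN0 : z.zer.1.2 = 0 := by
    ext v
    have := congrArg neg (smul_euler_lie h3 g (vneg T v))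
    rw [hzE] at this
    simp [hzp, hNK _ (hN v), comm_coe, inner_coe] at this
    apply two_smul_eq_zero (K := K)
    rw [← sub_eq_zero] at this
    rw [← this]
    abel
  refine mem_Pminus_of_euler h3 (c := z.neg) ?_
  rw [hzE]
  congr 1
  apply ext <;> simp [hzp, hzf, hN0]

end Annihilator

/-! ### Injectivity of induced maps -/

section Injective

variable {K : Type u} {V : Type v} [CommRing K] [AddCommGroup V] [Module K V]
variable {K' : Type u} {V' : Type v} [CommRing K'] [AddCommGroup V'] [Module K' V']
variable [Invertible (2 : K)] [Invertible (2 : K')] {T : JTS K V} {T' : JTS K' V'}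
variable {fp fm : V →+ V'}

/-- An injective `fp` lets the degree-one part and the action on V⁺ be compared after mapping.
Nothing is learned about V⁻, as `fm` may have a kernel. -/
theorem pos_zer_of_wordRel (h3' : IsUnit (3 : K'))
    (hf : IsPairHom T T' fp fm) (hinj : Function.Injective fp) {g : PE T} {g' : PE T'}
    (hg : (g, g') ∈ wordRel T T' fp fm) (h : g' ∈ Pminus T') :
    (g.1 (euler T)).pos = 0 ∧ (g.1 (euler T)).zer.1.1 = 1 := by
  obtain ⟨c, hc⟩ := (Pminus_apply h3' h).1
  have hr := (Related.euler (T := T) (T' := T') (fp := fp) (fm := fm)).smul hf hg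
  constructor
  · apply hinj
    rw [← hr.pos, hc, map_zero]
    simp
  · ext v
    apply hinj
    rw [← hr.zer_fst, hc]
    simp

theorem InducedBy.injective (h3 : IsUnit (3 : K)) (h3' : IsUnit (3 : K'))
    (hf : IsPairHom T T' fp fm) (hinj : Function.Injective fp) {Φp : Xp T → Xp T'}
    {Φm : Xm T → Xm T'} (h : InducedBy T T' fp fm Φp Φm) : Function.Injective Φp := by
  intro x y hxy
  obtain ⟨g, rfl⟩ := exists_smul_op x
  obtain ⟨k, rfl⟩ := exists_smul_op y
  obtain ⟨g', hg⟩ := exists_wordRel (T' := T') fp fm g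
  obtain ⟨k', hk⟩ := exists_wordRel (T' := T') fp fm k
  rw [h.smul_p hg, h.smul_p hk, h.base_p, smul_op_eq_iff] at hxy
  rw [smul_op_eq_iff]
  have hgk : (g⁻¹ * k, g'⁻¹ * k') ∈ wordRel T T' fp fm :=
    (wordRel T T' fp fm).mul_mem ((wordRel T T' fp fm).inv_mem hg) hk
  have hgk' : ((g⁻¹ * k)⁻¹, (g'⁻¹ * k')⁻¹) ∈ wordRel T T' fp fm :=
    (wordRel T T' fp fm).inv_mem hgk
  have h1 := pos_zer_of_wordRel h3' hf hinj hgk hxy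
  have h2 := pos_zer_of_wordRel h3' hf hinj hgk' (inv_mem hxy)
  exact mem_Pminus_of_pos_zer h3 h1.1 h1.2 h2.1 h2.2

end Injective

/-! ## Quasi-invertibility -/

section QuasiInverse

variable {K : Type u} {V : Type v} [CommRing K] [AddCommGroup V] [Module K V]
variable [Invertible (2 : K)] {T : JTS K V}

theorem tau_pos (v : V) (X : TKK T) : ((tau T v).1 X).pos =
    X.pos - X.zer.1.1 v + T.Q v X.neg := by
  rw [tau_apply]
  simp [comm_coe, inner_coe, JTS.Q]
  abel

/-- The three terms of the Bergman operator come from the components of exp(a)v in degrees 1, 0 and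
-1, brought to degree 1 by exp(-x). -/
theorem pos_tau_tauTilde_vpos (x a v : V) :
    (((tauTilde T (-a) * tau T x)⁻¹).1 (vpos T v)).pos = T.B x (-a) v := by
  rw [mul_inv_rev, tau_inv, tauTilde_inv, neg_neg, PE_mul_apply, tau_pos, tauTilde_apply]
  simp [comm_coe, inner_coe, JTS.Q, JTS.B, smul_smul, T.symm v a x]

theorem exists_chartP_eq_iff (h3 : IsUnit (3 : K)) (x a : V) :
    (∃ u, tauTilde T (-a) • chartP T x = chartP T u) ↔ IsUnit (T.B x (-a)) := by
  obtain ⟨k, hk⟩ : ∃ k, k = tauTilde T (-a) * tau T x := ⟨_, rfl⟩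
  have hB : ∀ v, (k⁻¹.1 (vpos T v)).pos = T.B x (-a) v := by
    rw [hk]
    exact pos_tau_tauTilde_vpos x a
  have hchart : ∀ u, tauTilde T (-a) • chartP T x = chartP T u ↔ k⁻¹ * tau T u ∈ Pminus T := by
    intro u
    rw [chartP, ← mul_smul, ← hk, chartP, smul_op_eq_iff]
  simp only [hchart]
  rw [Module.End.isUnit_iff]
  constructor
  · rintro ⟨u, hu⟩
    -- Elements of P⁻ preserve the part of degree at most zero, so they act invertibly on the
    -- quotient V⁺; there k⁻¹exp(u) acts as the Bergman operator.
    have hpos : ∀ h ∈ Pminus T, ∀ X : TKK T, X.pos = 0 → (h.1 X).pos = 0 := by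
      intro h hh X hX
      obtain ⟨c, hc⟩ := (Pminus_apply h3 hh).1
      obtain ⟨m, hm⟩ := (Pminus_apply h3 hh).2 X.neg
      have h1 : X = mk 0 X.zer 0 + vneg T X.neg := by apply ext <;> simp [hX]
      have h2 : ⁅euler T, mk 0 X.zer 0⁆ = (0 : TKK T) := by
        rw [← deg_eq_lie, deg_apply]; apply ext <;> simp
      have h4 := congrArg h.1 h2
      rw [PE_lie h3, hc, map_zero] at h4
      have h4 := congrArg pos h4
      simp at h4
      rw [h1, map_add, hm, pos_add, h4, pos_vneg, add_zero]
    have hmul : ∀ h ∈ Pminus T, ∀ v, (h.1 (vpos T (h⁻¹.1 (vpos T v)).pos)).pos = v := by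
      intro h hh v
      have := hpos h hh (h⁻¹.1 (vpos T v) - vpos T (h⁻¹.1 (vpos T v)).pos) (by simp)
      rw [map_sub, PE_apply_inv, pos_sub, sub_eq_zero] at this
      exact this.symm
    have hBu : ∀ v, T.B x (-a) v = ((k⁻¹ * tau T u).1 (vpos T v)).pos := fun v => by
      rw [PE_mul_apply, tau_vpos, hB]
    constructor
    · intro v w hvw
      rw [hBu, hBu] at hvw
      have h1 := hmul _ (inv_mem hu) v
      have h2 := hmul _ (inv_mem hu) w
      rw [inv_inv] at h1 h2
      rw [← h1, ← h2, hvw]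
    · intro v
      exact ⟨_, (hBu _).trans (hmul _ hu v)⟩
  · intro hb
    -- As exp(u) sends `euler` to `euler` - u, this u cancels the V⁺ component of k⁻¹exp(u) applied
    -- to `euler`.
    obtain ⟨u, hu⟩ := hb.2 (k⁻¹.1 (euler T)).pos
    refine ⟨u, ?_⟩
    obtain ⟨g, hg⟩ : ∃ g, g = k⁻¹ * tau T u := ⟨_, rfl⟩
    rw [← hg]
    have hgv : ∀ v, (g.1 (vpos T v)).pos = T.B x (-a) v := fun v => by
      rw [hg, PE_mul_apply, tau_vpos, hB]
    have hp : (g.1 (euler T)).pos = 0 := by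
      rw [hg, PE_mul_apply, tau_euler, map_sub, pos_sub, hB, hu, sub_self]
    -- Transporting [E,w] = w shows that gE fixes every B(w), and B is surjective. The eigenvectors
    -- for 0 and -1 are then seen to have no V⁺ component after applying g.
    have hf : (g.1 (euler T)).zer.1.1 = 1 := by
      ext v
      obtain ⟨w, rfl⟩ := hb.2 v
      have h : ⁅euler T, vpos T w⁆ = vpos T w := by
        rw [← deg_eq_lie, deg_apply]; apply ext <;> simp
      have := congrArg (fun X => (g.1 X).pos) h
      simp only [PE_lie h3, pos_lie, hp, map_zero, sub_zero, hgv] at this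
      exact this
    have hz : ∀ A : T.Der, (g.1 (mk 0 A 0)).pos = 0 := by
      intro A
      have h : ⁅euler T, mk 0 A 0⁆ = (0 : TKK T) := by
        rw [← deg_eq_lie, deg_apply]; apply ext <;> simp
      have := congrArg (fun X => (g.1 X).pos) h
      simpa only [PE_lie h3, pos_lie, hp, map_zero, sub_zero, hf, Module.End.one_apply,
        pos_zero] using this
    have hn : ∀ c, (g.1 (vneg T c)).pos = 0 := by
      intro c
      have h : ⁅euler T, vneg T c⁆ = -vneg T c := by
        rw [← deg_eq_lie, deg_apply]; apply ext <;> simp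
      have := congrArg (fun X => (g.1 X).pos) h
      simp only [PE_lie h3, pos_lie, hp, map_zero, sub_zero, hf, Module.End.one_apply,
        map_neg, pos_neg] at this
      exact two_smul_eq_zero (K := K) (by rw [two_smul, add_eq_zero_iff_eq_neg]; exact this)
    have hgX : ∀ X, (g.1 X).pos = T.B x (-a) X.pos := by
      intro X
      have h : X = vpos T X.pos + mk 0 X.zer 0 + vneg T X.neg := by apply ext <;> simp
      conv_lhs => rw [h]
      simp only [map_add, pos_add, hgv, hz, hn, add_zero]
    -- Since g acts on the quotient V⁺ as B, injectivity of B gives the conditions on g⁻¹.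
    have hp' : (g⁻¹.1 (euler T)).pos = 0 := by
      apply hb.1
      rw [← hgX, PE_apply_inv, pos_euler, map_zero]
    refine mem_Pminus_of_pos_zer h3 hp hf hp' ?_
    ext v
    apply hb.1
    have h : (⁅g⁻¹.1 (euler T), vpos T v⁆ : TKK T).pos = (g⁻¹.1 (euler T)).zer.1.1 v := by
      simp
    rw [← h, ← hgX, PE_lie h3, PE_apply_inv, pos_lie, hgv]
    simp

/-- Applying exp(-a) moves the second point to o⁻, and by P⁺ = U⁺H the points transversal to o⁻ are
those of the chart. -/
theorem transv_chart_iff (h3 : IsUnit (3 : K)) (x a : V) :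
    Transv T (chartP T x) (chartM T a) ↔ IsUnit (T.B x (-a)) := by
  rw [← exists_chartP_eq_iff h3]
  constructor
  · rintro ⟨g, hg, hg'⟩
    rw [chartM, eq_comm, smul_om_eq_iff] at hg'
    obtain ⟨u, h, hh, hu⟩ := exists_of_mem_Pplus h3 hg'
    refine ⟨u, ?_⟩
    rw [← hg, ← tauTilde_inv, ← mul_smul, hu, chartP, smul_op_eq_iff, mul_inv_rev,
      inv_mul_cancel_right]
    exact inv_mem (Subgroup.mem_sup_right hh)
  · rintro ⟨u, hu⟩
    refine ⟨tauTilde T a * tau T u, ?_, ?_⟩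
    · rw [mul_smul, ← chartP, ← hu, ← tauTilde_inv, smul_inv_smul]
    · rw [chartM, smul_om_eq_iff, mul_inv_rev, inv_mul_cancel_right]
      exact inv_mem (tau_mem_Pplus u)

end QuasiInverse

/-! ## Polarities induced by grading-reversing involutions -/

section Polarity

variable {K : Type u} {V : Type v} [CommRing K] [AddCommGroup V] [Module K V]
  [Invertible (2 : K)] {T : JTS K V}

namespace AntiGraded

variable (c : AntiGraded T)

theorem mapP_smul (g : PE T) (x : Xp T) : c.mapP (g • x) = c.conj g • c.mapP x := by
  induction x using QuotientGroup.induction_on with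
  | H h =>
    change ((c.conj (g * h) : PE T) : Xm T) = ((c.conj g * c.conj h : PE T) : Xm T)
    rw [map_mul]

theorem mapM_smul (g : PE T) (x : Xm T) : c.mapM (g • x) = c.conj g • c.mapM x := by
  induction x using QuotientGroup.induction_on with
  | H h =>
    change ((c.conj (g * h) : PE T) : Xp T) = ((c.conj g * c.conj h : PE T) : Xp T)
    rw [map_mul]

theorem mapP_op : c.mapP (op T) = om T := by
  change ((c.conj 1 : PE T) : Xm T) = ((1 : PE T) : Xm T)
  rw [map_one]

theorem mapM_om : c.mapM (om T) = op T := by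
  change ((c.conj 1 : PE T) : Xp T) = ((1 : PE T) : Xp T)
  rw [map_one]

theorem mapP_chartP (v : V) : c.mapP (chartP T v) = chartM T (c.f v) := by
  rw [chartP, c.mapP_smul, c.conj_tau, c.mapP_op, chartM]

theorem mapM_chartM (v : V) : c.mapM (chartM T v) = chartP T (c.g v) := by
  rw [chartM, c.mapM_smul, c.conj_tauTilde, c.mapM_om, chartP]

/-- The grading-reversing automorphism is a linear involution on `V⁺ ∪ V⁻`. -/
structure IsLinearInvolution : Prop where
  f_add : ∀ v w, c.f (v + w) = c.f v + c.f w
  g_add : ∀ v w, c.g (v + w) = c.g v + c.g w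
  f_smul : ∀ (r : K) v, c.f (r • v) = r • c.f v
  g_smul : ∀ (r : K) v, c.g (r • v) = r • c.g v
  g_f : ∀ v, c.g (c.f v) = v
  f_g : ∀ v, c.f (c.g v) = v

variable {c}

namespace IsLinearInvolution

theorem conj_conj (h : c.IsLinearInvolution) (g : PE T) : c.conj (c.conj g) = g := by
  induction g using PE_induction with
  | one => simp
  | mul_tau v g ih => rw [map_mul, map_mul, ih, c.conj_tau, c.conj_tauTilde, h.g_f]
  | mul_tauTilde v g ih => rw [map_mul, map_mul, ih, c.conj_tauTilde, c.conj_tau, h.f_g]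

theorem mapM_mapP (h : c.IsLinearInvolution) (x : Xp T) : c.mapM (c.mapP x) = x := by
  obtain ⟨g, rfl⟩ := exists_smul_op x
  rw [c.mapP_smul, c.mapM_smul, c.mapP_op, c.mapM_om, h.conj_conj]

theorem mapP_mapM (h : c.IsLinearInvolution) (x : Xm T) : c.mapP (c.mapM x) = x := by
  obtain ⟨g, rfl⟩ := exists_smul_om x
  rw [c.mapM_smul, c.mapP_smul, c.mapM_om, c.mapP_op, h.conj_conj]

/-- Interchanging V⁺ and V⁻ inverts the weights of the dilation, in accordance with the inverse
scalar in `DilM`. -/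
theorem conj_scaling (h : c.IsLinearInvolution) (r : Kˣ) (g : PE T) :
    c.conj ((scaling T r).conj g) = (scaling T r⁻¹).conj (c.conj g) := by
  induction g using PE_induction with
  | one => simp
  | mul_tau v g ih =>
    rw [map_mul, map_mul, map_mul, map_mul, ih, c.conj_tau, (scaling T r).conj_tau, c.conj_tau,
      (scaling T r⁻¹).conj_tauTilde]
    simp only [scaling, h.f_smul, inv_inv]
  | mul_tauTilde v g ih =>
    rw [map_mul, map_mul, map_mul, map_mul, ih, c.conj_tauTilde, (scaling T r).conj_tauTilde,
      c.conj_tauTilde, (scaling T r⁻¹).conj_tau]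
    simp only [scaling, h.g_smul]

theorem mapP_scaling (h : c.IsLinearInvolution) (r : Kˣ) (x : Xp T) :
    c.mapP ((scaling T r).mapP x) = (scaling T r⁻¹).mapM (c.mapP x) := by
  obtain ⟨g, rfl⟩ := exists_smul_op x
  rw [Graded.mapP_smul, c.mapP_smul, c.mapP_smul, Graded.mapM_smul, Graded.mapP_op, c.mapP_op,
    Graded.mapM_om, h.conj_scaling]

theorem mapM_scaling (h : c.IsLinearInvolution) (r : Kˣ) (x : Xm T) :
    c.mapM ((scaling T r⁻¹).mapM x) = (scaling T r).mapP (c.mapM x) := by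
  obtain ⟨g, rfl⟩ := exists_smul_om x
  rw [Graded.mapM_smul, c.mapM_smul, c.mapM_smul, Graded.mapP_smul, Graded.mapM_om, c.mapM_om,
    Graded.mapP_op, h.conj_scaling, inv_inv]

theorem transv (h : c.IsLinearInvolution) (x : Xp T) (a : Xm T) :
    Transv T x a ↔ Transv T (c.mapM a) (c.mapP x) := by
  have key : ∀ x a, Transv T x a → Transv T (c.mapM a) (c.mapP x) := by
    rintro _ _ ⟨g, rfl, rfl⟩
    exact ⟨c.conj g, by rw [c.mapM_smul, c.mapM_om], by rw [c.mapP_smul, c.mapP_op]⟩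
  exact ⟨key x a, fun k => by simpa only [h.mapM_mapP, h.mapP_mapM] using key _ _ k⟩

theorem piM_of_piP {r : K} {x : Xp T} {a : Xm T} {y z : Xp T} (h : c.IsLinearInvolution)
    (k : PiP T r x a y z) : PiM T r (c.mapP x) (c.mapM a) (c.mapP y) (c.mapP z) := by
  obtain ⟨g, u, rfl, rfl, rfl, rfl⟩ := k
  exact ⟨c.conj g, c.f u, by rw [c.mapM_smul, c.mapM_om], by rw [c.mapP_smul, c.mapP_op],
    by rw [c.mapP_smul, c.mapP_chartP], by rw [c.mapP_smul, c.mapP_chartP, h.f_smul]⟩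

theorem piP_of_piM {r : K} {a : Xm T} {x : Xp T} {b d : Xm T} (h : c.IsLinearInvolution)
    (k : PiM T r a x b d) : PiP T r (c.mapM a) (c.mapP x) (c.mapM b) (c.mapM d) := by
  obtain ⟨g, u, rfl, rfl, rfl, rfl⟩ := k
  exact ⟨c.conj g, c.g u, by rw [c.mapM_smul, c.mapM_om], by rw [c.mapP_smul, c.mapP_op],
    by rw [c.mapM_smul, c.mapM_chartM], by rw [c.mapM_smul, c.mapM_chartM, h.g_smul]⟩

theorem sigmaM_of_sigmaP {x : Xp T} {a : Xm T} {y z w : Xp T} (h : c.IsLinearInvolution)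
    (k : SigmaP T x a y z w) :
    SigmaM T (c.mapP x) (c.mapM a) (c.mapP y) (c.mapP z) (c.mapP w) := by
  obtain ⟨g, u, v, rfl, rfl, rfl, rfl, rfl⟩ := k
  exact ⟨c.conj g, c.f u, c.f v, by rw [c.mapM_smul, c.mapM_om], by rw [c.mapP_smul, c.mapP_op],
    by rw [c.mapP_smul, c.mapP_chartP], by rw [c.mapP_smul, c.mapP_chartP],
    by rw [c.mapP_smul, c.mapP_chartP, h.f_add]⟩

theorem sigmaP_of_sigmaM {a : Xm T} {x : Xp T} {b d e : Xm T} (h : c.IsLinearInvolution)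
    (k : SigmaM T a x b d e) :
    SigmaP T (c.mapM a) (c.mapP x) (c.mapM b) (c.mapM d) (c.mapM e) := by
  obtain ⟨g, u, v, rfl, rfl, rfl, rfl, rfl⟩ := k
  exact ⟨c.conj g, c.g u, c.g v, by rw [c.mapM_smul, c.mapM_om], by rw [c.mapP_smul, c.mapP_op],
    by rw [c.mapM_smul, c.mapM_chartM], by rw [c.mapM_smul, c.mapM_chartM],
    by rw [c.mapM_smul, c.mapM_chartM, h.g_add]⟩

theorem dilM_of_dilP {r : Kˣ} {x : Xp T} {a : Xm T} {y z : Xp T} (h : c.IsLinearInvolution)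
    (k : DilP T r x a y z) : DilM T r (c.mapP x) (c.mapM a) (c.mapP y) (c.mapP z) := by
  obtain ⟨g, rfl, rfl, rfl⟩ := k
  exact ⟨c.conj g, by rw [c.mapM_smul, c.mapM_om], by rw [c.mapP_smul, c.mapP_op],
    by rw [c.mapP_smul, h.mapP_scaling, c.mapP_smul, map_inv]⟩

theorem dilP_of_dilM {r : Kˣ} {a : Xm T} {x : Xp T} {b d : Xm T} (h : c.IsLinearInvolution)
    (k : DilM T r a x b d) : DilP T r (c.mapM a) (c.mapP x) (c.mapM b) (c.mapM d) := by
  obtain ⟨g, rfl, rfl, rfl⟩ := k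
  exact ⟨c.conj g, by rw [c.mapM_smul, c.mapM_om], by rw [c.mapP_smul, c.mapP_op],
    by rw [c.mapM_smul, h.mapM_scaling, c.mapM_smul, map_inv]⟩

/-- The two induced maps are mutually inverse, so each converse is the dual implication applied to
the images. -/
theorem isPolarity (h : c.IsLinearInvolution) : IsPolarity T c.mapP := by
  refine ⟨⟨c.mapM, h.mapM_mapP, h.mapP_mapM, h.transv,
    fun r x a y z => ⟨h.piM_of_piP, fun k => ?_⟩, fun r x a y z => ⟨h.piP_of_piM, fun k => ?_⟩,
    fun x a y z w => ⟨h.sigmaM_of_sigmaP, fun k => ?_⟩,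
    fun x a y z w => ⟨h.sigmaP_of_sigmaM, fun k => ?_⟩,
    fun r x a y z => ⟨h.dilM_of_dilP, fun k => ?_⟩,
    fun r x a y z => ⟨h.dilP_of_dilM, fun k => ?_⟩⟩, op T, 1, one_smul _ _, ?_⟩
  · simpa only [h.mapM_mapP, h.mapP_mapM] using h.piP_of_piM k
  · simpa only [h.mapM_mapP, h.mapP_mapM] using h.piM_of_piP k
  · simpa only [h.mapM_mapP, h.mapP_mapM] using h.sigmaP_of_sigmaM k
  · simpa only [h.mapM_mapP, h.mapP_mapM] using h.sigmaM_of_sigmaP k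
  · simpa only [h.mapM_mapP, h.mapP_mapM] using h.dilP_of_dilM k
  · simpa only [h.mapM_mapP, h.mapP_mapM] using h.dilM_of_dilP k
  · rw [one_smul, c.mapP_op]

end IsLinearInvolution

end AntiGraded

/-- The exchange automorphism composed with the automorphism `(β, β⁻¹)`. -/
def strExchange (T : JTS K V) (β : V ≃ₗ[K] V) (hβ : T.IsStructural β.toLinearMap) :
    AntiGraded T where
  θ := (strEquiv T β hβ).trans (exchangeEquiv T)
  f := β
  g := β.symm
  θ_pos v := (congrArg (exchangeEquiv T) ((strAut T β hβ).θ_pos v)).trans ((exchange T).θ_pos _)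
  θ_neg v := (congrArg (exchangeEquiv T) ((strAut T β hβ).θ_neg v)).trans ((exchange T).θ_neg _)
  θ_deg X := (congrArg (exchangeEquiv T) ((strAut T β hβ).θ_deg X)).trans ((exchange T).θ_deg _)

theorem strExchange_isLinearInvolution (T : JTS K V) (β : V ≃ₗ[K] V)
    (hβ : T.IsStructural β.toLinearMap) : (strExchange T β hβ).IsLinearInvolution where
  f_add := map_add β
  g_add := map_add β.symm
  f_smul := map_smul β
  g_smul := map_smul β.symm
  g_f := β.symm_apply_apply
  f_g := β.apply_symm_apply

theorem polComp_eq (T : JTS K V) (β : V ≃ₗ[K] V) (hβ : T.IsStructural β.toLinearMap) :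
    polComp T β hβ = (strExchange T β hβ).mapP := by
  ext x
  obtain ⟨g, rfl⟩ := exists_smul_op x
  rw [polComp, pol, Function.comp_apply, Graded.mapP_smul, AntiGraded.mapP_smul, Graded.mapP_op,
    AntiGraded.mapP_op, AntiGraded.mapP_smul, AntiGraded.mapP_op]
  congr 1

theorem pol_tau (T : JTS K V) (v : V) (x : Xp T) : pol T (tau T v • x) = tauTilde T v • pol T x := by
  rw [pol, AntiGraded.mapP_smul, AntiGraded.conj_tau]
  rfl

theorem pol_tauTilde (T : JTS K V) (v : V) (x : Xp T) :
    pol T (tauTilde T v • x) = tau T v • pol T x := by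
  rw [pol, AntiGraded.mapP_smul, AntiGraded.conj_tauTilde]
  rfl

theorem pol_op (T : JTS K V) : pol T (op T) = om T := AntiGraded.mapP_op _

theorem pol_chartP (T : JTS K V) (v : V) : pol T (chartP T v) = chartM T v := by
  rw [chartP, pol_tau, pol_op, chartM]

end Polarity

/-! ## The maps induced by structural transformations -/

section Homotope

variable {K : Type u} {V : Type v} [CommRing K] [AddCommGroup V] [Module K V]

theorem homotope_tri (T : JTS K V) (α : V →ₗ[K] V) (hα : T.IsStructural α) (x y z : V) :
    (T.homotope α hα).tri x y z = T.tri x (α y) z := rfl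

theorem isPairHom_homotope (T : JTS K V) (α : V →ₗ[K] V) (hα : T.IsStructural α) :
    IsPairHom (T.homotope α hα) T (AddMonoidHom.id V) α.toAddMonoidHom where
  map_pos _ _ _ := rfl
  map_neg a x b := (hα a x b).symm

theorem isPairHom_homotope_symm [Invertible (2 : K)] (T : JTS K V) (β : V ≃ₗ[K] V)
    (hβ : T.IsStructural β.toLinearMap) :
    IsPairHom T (T.homotope β.toLinearMap hβ) (AddMonoidHom.id V)
      β.symm.toLinearMap.toAddMonoidHom where
  map_pos x a y := by simp [homotope_tri]
  map_neg a x b := by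
    have := strAut_aux' hβ a x b
    simpa [homotope_tri] using this.symm

/-- The inclusion of `V` into its scalar extension by dual numbers. -/
def dualIncl (V : Type v) [AddCommGroup V] : V →+ DualExt V where
  toFun v := DualExt.mk v 0
  map_zero' := rfl
  map_add' x y := by apply DualExt.ext <;> simp

@[simp] theorem re_dualIncl (v : V) : (dualIncl V v).re = v := rfl
@[simp] theorem im_dualIncl (v : V) : (dualIncl V v).im = 0 := rfl

theorem isPairHom_dual (T : JTS K V) : IsPairHom T T.dual (dualIncl V) (dualIncl V) where
  map_pos x a y := by apply DualExt.ext <;> simp [JTS.dual_apply]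
  map_neg x a y := by apply DualExt.ext <;> simp [JTS.dual_apply]

theorem isPairHom_dual_homotope (T : JTS K V) (α : V →ₗ[K] V) (hα : T.IsStructural α) :
    IsPairHom (T.homotope α hα) (T.dual.homotope (DualExt.map α) hα.dual) (dualIncl V)
      (dualIncl V) where
  map_pos x a y := by
    apply DualExt.ext <;> simp [JTS.dual_apply, homotope_tri]
  map_neg x a y := by
    apply DualExt.ext <;> simp [JTS.dual_apply, homotope_tri]

theorem isUnit_three_dualNumber (h3 : IsUnit (3 : K)) : IsUnit (3 : DualNumber K) := by
  have := h3.map (algebraMap K (DualNumber K))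
  rwa [map_ofNat] at this

/-! ### Tangent map, affine image and symmetric space -/

variable [Invertible (2 : K)] {T : JTS K V} {α : V →ₗ[K] V} {hα : T.IsStructural α}
variable {Φp : Xp (T.homotope α hα) → Xp T} {Φm : Xm (T.homotope α hα) → Xm T}

/-- In the quadratic term the structural identity turns αT(x,αv,x) into T(αx,v,αx). -/
theorem homotope_B (T : JTS K V) (α : V →ₗ[K] V) (hα : T.IsStructural α) (x : V) :
    (T.homotope α hα).B x (-x) = T.B x (-α x) := by
  ext v
  simp [JTS.B, JTS.Q, homotope_tri, hα _ _ _]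

/-- Uniqueness is injectivity of the chart over the dual numbers. For existence, both ways around
the square are induced by the same pair of maps, hence agree. -/
theorem isTangentMap_iff (h3 : IsUnit (3 : K)) (h : InducedBy (T.homotope α hα) T id α Φp Φm)
    (L : V →ₗ[K] V) : IsTangentMap T α hα Φp Φm L ↔ L = LinearMap.id := by
  have h3' := isUnit_three_dualNumber h3
  constructor
  · rintro ⟨-, -, -, -, Ψp, Ψm, -, -, hΨ, -, -, hL⟩
    ext v
    have := chartP_injective h3' ((hΨ.chartP _).symm.trans (hL v))
    exact (congrArg DualExt.im this).symm
  · rintro rfl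
    obtain ⟨ιp, ιm, hι⟩ := exists_inducedBy h3 h3' (isPairHom_dual_homotope T α hα)
    obtain ⟨κp, κm, hκ⟩ := exists_inducedBy h3 h3' (isPairHom_dual T)
    obtain ⟨Ψp, Ψm, hΨ⟩ := exists_inducedBy h3' h3'
      (isPairHom_homotope T.dual (DualExt.map α) hα.dual)
    have h1 := hΨ.comp hι
    have h2 := hκ.comp h
    have hm : (DualExt.map α).toAddMonoidHom ∘ dualIncl V = dualIncl V ∘ α := by
      ext v
      apply DualExt.ext <;> simp
    rw [hm] at h1
    obtain ⟨hp, hm⟩ := h1.unique h2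
    exact ⟨ιp, ιm, κp, κm, Ψp, Ψm, hι, hκ, hΨ, congrFun hp, congrFun hm, fun v => hΨ.chartP _⟩

theorem InducedBy.injective_homotope (h3 : IsUnit (3 : K))
    (h : InducedBy (T.homotope α hα) T id α Φp Φm) : Function.Injective Φp :=
  InducedBy.injective h3 h3 (isPairHom_homotope T α hα) Function.injective_id h

/-- By injectivity a chart point lies in the image only if the same chart point of the homotope lies
in M_α, where the transversality criterion applies. -/
theorem InducedBy.preimage_image_symSpace (h3 : IsUnit (3 : K))
    (h : InducedBy (T.homotope α hα) T id α Φp Φm) :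
    JordanPolar.chartP T ⁻¹' (Φp '' symSpace (T.homotope α hα) (pol (T.homotope α hα))) =
      {x | IsUnit (T.B x (-α x))} := by
  ext x
  have hx : Φp (JordanPolar.chartP (T.homotope α hα) x) = JordanPolar.chartP T x := h.chartP x
  rw [Set.mem_preimage, ← hx, (h.injective_homotope h3).mem_set_image, symSpace,
    Set.mem_ofPred_eq, pol_chartP, transv_chart_iff h3, homotope_B, Set.mem_ofPred_eq]

variable {β : V ≃ₗ[K] V} {hβ : T.IsStructural β.toLinearMap}
  {Φp : Xp (T.homotope β.toLinearMap hβ) → Xp T} {Φm : Xm (T.homotope β.toLinearMap hβ) → Xm T}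

/-- Both sides transform alike under each generator, so induction along a word suffices. -/
theorem InducedBy.polComp (h : InducedBy (T.homotope β.toLinearMap hβ) T id β Φp Φm)
    (x : Xp (T.homotope β.toLinearMap hβ)) :
    JordanPolar.polComp T β hβ (Φp x) = Φm (pol (T.homotope β.toLinearMap hβ) x) := by
  rw [polComp_eq]
  obtain ⟨g, rfl⟩ := exists_smul_op x
  induction g using PE_induction with
  | one => rw [one_smul, h.base_p, pol_op, h.base_m, AntiGraded.mapP_op]
  | mul_tau v g ih =>
    rw [mul_smul, h.tau_p, pol_tau, h.tauTilde_m, AntiGraded.mapP_smul, AntiGraded.conj_tau, ih]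
    rfl
  | mul_tauTilde v g ih =>
    rw [mul_smul, h.tauTilde_p, pol_tauTilde, h.tau_m, AntiGraded.mapP_smul,
      AntiGraded.conj_tauTilde, ih]
    congr 2
    -- The V⁻ letter v becomes βv in T, and the twisted exchange returns it to V⁺ through β⁻¹.
    exact β.symm_apply_apply v

/-- The pair (id, β⁻¹) is a homomorphism in the opposite direction; both composites are induced by
identities, hence are identities. -/
theorem InducedBy.exists_inverse (h3 : IsUnit (3 : K))
    (h : InducedBy (T.homotope β.toLinearMap hβ) T id β Φp Φm) :
    ∃ Ψp Ψm, IsHom T (T.homotope β.toLinearMap hβ) Ψp Ψm ∧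
      (∀ x, Ψp (Φp x) = x) ∧ (∀ x, Ψm (Φm x) = x) ∧ (∀ x, Φp (Ψp x) = x) := by
  obtain ⟨Ψp, Ψm, hΨ⟩ := exists_inducedBy h3 h3 (isPairHom_homotope_symm T β hβ)
  have h1 := hΨ.comp h
  have h2 := h.comp hΨ
  have e1 : β.symm.toLinearMap.toAddMonoidHom ∘ β = id := funext β.symm_apply_apply
  have e2 : β ∘ β.symm.toLinearMap.toAddMonoidHom = id := funext β.apply_symm_apply
  rw [e1] at h1
  rw [e2] at h2
  obtain ⟨hp, hm⟩ := h1.unique (InducedBy.refl _)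
  obtain ⟨hp', -⟩ := h2.unique (InducedBy.refl _)
  exact ⟨Ψp, Ψm, InducedBy.isHom (fp := LinearMap.id) (fm := β.symm.toLinearMap) hΨ,
    congrFun hp, congrFun hm, congrFun hp'⟩

theorem InducedBy.image_symSpace (h3 : IsUnit (3 : K))
    (h : InducedBy (T.homotope β.toLinearMap hβ) T id β Φp Φm) :
    Φp '' symSpace _ (pol (T.homotope β.toLinearMap hβ)) =
      symSpace T (JordanPolar.polComp T β hβ) := by
  obtain ⟨Ψp, Ψm, hΨ, hp, hm, hp'⟩ := h.exists_inverse h3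
  have hΦ : IsHom _ T Φp Φm := InducedBy.isHom (fp := LinearMap.id) (fm := β.toLinearMap) h
  ext x
  constructor
  · rintro ⟨y, hy, rfl⟩
    change Transv _ _ _
    rw [h.polComp]
    exact hΦ.transv _ _ hy
  · intro hx
    refine ⟨Ψp x, ?_, hp' x⟩
    have := hΨ.transv _ _ hx
    nth_rw 2 [← hp' x] at this
    rwa [h.polComp, hm] at this

theorem InducedBy.symMul_iff (h3 : IsUnit (3 : K))
    (h : InducedBy (T.homotope β.toLinearMap hβ) T id β Φp Φm)
    (x y z : Xp (T.homotope β.toLinearMap hβ)) :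
    symMul _ (pol (T.homotope β.toLinearMap hβ)) x y z ↔
      symMul T (JordanPolar.polComp T β hβ) (Φp x) (Φp y) (Φp z) := by
  obtain ⟨Ψp, Ψm, hΨ, hp, hm, hp'⟩ := h.exists_inverse h3
  have hΦ : IsHom _ T Φp Φm := InducedBy.isHom (fp := LinearMap.id) (fm := β.toLinearMap) h
  rw [symMul, symMul, h.polComp]
  refine ⟨hΦ.dilP _ _ _ _ _, fun k => ?_⟩
  simpa only [hp, hm] using hΨ.dilP _ _ _ _ _ k

end Homotope

end JordanPolar

end

theorem theorem4p3 {K : Type*} [CommRing K] [Invertible (2 : K)] (h3 : IsUnit (3 : K))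
    {V : Type*} [AddCommGroup V] [Module K V] (T : JordanPolar.JTS K V)
    (α : V →ₗ[K] V) (hα : T.IsStructural α) :
    -- the pair of maps induced by `(id, α) : (V_α, V_α) → (V, V)` exists and is unique
    (∃! Φ : (JordanPolar.Xp (T.homotope α hα) → JordanPolar.Xp T) ×
        (JordanPolar.Xm (T.homotope α hα) → JordanPolar.Xm T),
      JordanPolar.InducedBy (T.homotope α hα) T id α Φ.1 Φ.2) ∧
    ∀ (Φp : JordanPolar.Xp (T.homotope α hα) → JordanPolar.Xp T)
      (Φm : JordanPolar.Xm (T.homotope α hα) → JordanPolar.Xm T),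
      JordanPolar.InducedBy (T.homotope α hα) T id α Φp Φm →
      -- it is a homomorphism of geometries with injective first component
      JordanPolar.IsHom (T.homotope α hα) T Φp Φm ∧
      Function.Injective Φp ∧
      -- (1) the affine part of the image of `M_α`
      JordanPolar.chartP T ⁻¹' (Φp '' JordanPolar.symSpace (T.homotope α hα)
          (JordanPolar.pol (T.homotope α hα))) = {x | IsUnit (T.B x (-α x))} ∧
      -- (2) in the affine charts `Φp` is the identity, and so is its algebraic tangent map
      (∀ v, Φp (JordanPolar.chartP (T.homotope α hα) v) = JordanPolar.chartP T v) ∧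
      (∀ L : V →ₗ[K] V, JordanPolar.IsTangentMap T α hα Φp Φm L ↔ L = LinearMap.id) ∧
      -- (3) the image of `M_α` for invertible `α`
      (∀ (β : V ≃ₗ[K] V) (hβ : T.IsStructural β.toLinearMap), β.toLinearMap = α →
        JordanPolar.IsPolarity T (JordanPolar.polComp T β hβ) ∧
        Φp '' JordanPolar.symSpace (T.homotope α hα) (JordanPolar.pol (T.homotope α hα)) =
          JordanPolar.symSpace T (JordanPolar.polComp T β hβ) ∧
        ∀ x ∈ JordanPolar.symSpace (T.homotope α hα) (JordanPolar.pol (T.homotope α hα)),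
        ∀ y ∈ JordanPolar.symSpace (T.homotope α hα) (JordanPolar.pol (T.homotope α hα)),
        ∀ z, JordanPolar.symMul (T.homotope α hα) (JordanPolar.pol (T.homotope α hα)) x y z ↔
          JordanPolar.symMul T (JordanPolar.polComp T β hβ) (Φp x) (Φp y) (Φp z)) := by
  refine ⟨?_, fun Φp Φm h => ⟨?_, h.injective_homotope h3, h.preimage_image_symSpace h3,
    fun v => h.chartP v, JordanPolar.isTangentMap_iff h3 h, ?_⟩⟩
  · obtain ⟨Φp, Φm, h⟩ :=
      JordanPolar.exists_inducedBy h3 h3 (JordanPolar.isPairHom_homotope T α hα)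
    refine ⟨(Φp, Φm), h, fun Ψ hΨ => ?_⟩
    obtain ⟨hp, hm⟩ := hΨ.unique h
    exact Prod.ext hp hm
  · exact JordanPolar.InducedBy.isHom (fp := LinearMap.id) (fm := α) h
  · rintro β hβ rfl
    refine ⟨?_, h.image_symSpace h3, fun x _ y _ z => h.symMul_iff h3 x y z⟩
    rw [JordanPolar.polComp_eq]
    exact (JordanPolar.strExchange_isLinearInvolution T β hβ).isPolarity
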